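/- **Duality Theorem.** *Conventions.* An inverse semigroup carries its natural partial order ($a\le b$ iff $a=be$ for some idempotent $e$), and $E(S)$ is its set of idempotents; "Boolean algebra" means generalized Boolean algebra (a top element is not required). Elements $a,b$ are compatible if $a^{-1}b$ and $ab^{-1}$ are idempotent. A *Boolean inverse $\wedge$-semigroup* is an inverse semigroup with zero in which every pair of elements has a meet, every finite nonempty compatible subset has a join, multiplication on either side distributes over these joins, and $E(S)$ is a Boolean algebra. A *filter* is a nonempty, down-directed, upwards closed subset not containing $0$; an *ultrafilter* is a maximal filter. A *proper morphism* is a semigroup homomorphism that preserves binary meets, restricts to a homomorphism of Boolean algebras $E(S)\to E(T)$ (in particular preserves $0$), and for which inverse images of ultrafilters are ultrafilters. For a groupoid $G$ (identified with its set of arrows) let $G_o$ be its set of identities, and let $\mathbf d(g)=g^{-1}g$ and $\mathbf r(g)=gg^{-1}$. A *local bisection* is a subset $A\subseteq G$ with $A^{-1}A,\,AA^{-1}\subseteq G_o$. A *Hausdorff Boolean groupoid* is a Hausdorff topological groupoid $G$ that is étale ($\mathbf d\colon G\to G_o$ is a local homeomorphism), has a basis of compact-open local bisections, and whose space of identities $G_o$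 is a Boolean space, i.e. a Hausdorff space with a basis of compact-open sets. A *covering functor* $\theta\colon G\to H$ is a functor that is star-injective ($\theta(g)=\theta(g')$ and $\mathbf d(g)=\mathbf d(g')$ imply $g=g'$) and star-surjective (if $e\in G_o$ and $\mathbf d(h)=\theta(e)$, then there is $g$ with $\mathbf d(g)=e$ and $\theta(g)=h$). A map is *proper* if inverse images of compact sets are compact. *The functors.* For a Boolean inverse $\wedge$-semigroup $S$, let $\mathsf G(S)$ be the set of ultrafilters of $S$, with inverse $A\mapsto A^{-1}=\{a^{-1}: a\in A\}$ and product $A\cdot B=(AB)^{\uparrow}$ defined when $A^{-1}\cdot A=B\cdot B^{-1}$, and with the topology generated by the sets $V_a=\{A: a\in A\}$, $a\in S$; a proper morphism $\theta\colon S\to T$ is sent to $\theta^{-1}\colon\mathsf G(T)\to\mathsf G(S)$. For a Hausdorff Boolean groupoid $G$, let $\mathsf B(G)$ be the set of compact-open local bisections of $G$ under multiplication and inversion of subsets; a proper continuous covering functor $\alpha\colon G\to H$ is sent to $\alpha^{-1}\colon\mathsf B(H)\to\mathsf B(G)$. *Theorem.* 1. $\mathsf G$ and $\mathsf B$ are contravariant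 functors between the category of Boolean inverse $\wedge$-semigroups and proper morphisms and the category of Hausdorff Boolean groupoids and proper continuous covering functors, and they are mutually quasi-inverse. Thus they give a dual equivalence of these two categories. 2. This generalizes classical Stone duality: the category of Boolean algebras and proper homomorphisms (lattice homomorphisms that preserve the bottom element and for which every element of the codomain lies beneath an element of the image) embeds fully and faithfully in the first category, a Boolean algebra being regarded as a semigroup under meet; the category of Boolean spaces and proper continuous maps embeds fully and faithfully in the second, a space being regarded as a groupoid all of whose arrows are identities; and there is a dual equivalence between Boolean algebras and Boolean spaces that agrees, up to natural isomorphism along these embeddings, with $\mathsf G$. -/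

import Mathlib

open CategoryTheory Topology

universe u

namespace BoolInv

/-! ### Inverse semigroups with zero -/

/-- An inverse semigroup: every `a` has a unique generalized inverse `a⁻¹`. -/
class InverseSemigroup (S : Type u) extends Semigroup S, Inv S where
  mul_inv_mul (a : S) : a * a⁻¹ * a = a
  inv_mul_inv (a : S) : a⁻¹ * a * a⁻¹ = a⁻¹
  inv_unique (a b : S) : a * b * a = a → b * a * b = b → b = a⁻¹

/-- An inverse semigroup with a zero element. -/
class InverseSemigroupWithZero (S : Type u) extends InverseSemigroup S, Zero S where
  zero_mul' (a : S) : 0 * a = 0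
  mul_zero' (a : S) : a * 0 = 0

/-- `E(S)`, the set of idempotents. -/
abbrev Idem (S : Type u) [Mul S] : Type u := {e : S // IsIdempotentElem e}

section order

variable {S : Type u} [InverseSemigroup S]

theorem inv_inv' (a : S) : a⁻¹⁻¹ = a :=
  (InverseSemigroup.inv_unique _ _ (InverseSemigroup.inv_mul_inv a)
    (InverseSemigroup.mul_inv_mul a)).symm

theorem idem_inv {e : S} (he : IsIdempotentElem e) : e⁻¹ = e :=
  (InverseSemigroup.inv_unique e e (by rw [he.eq, he.eq]) (by rw [he.eq, he.eq])).symm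

theorem idem_mul_inv (a : S) : IsIdempotentElem (a * a⁻¹) := by
  unfold IsIdempotentElem
  rw [← mul_assoc, InverseSemigroup.mul_inv_mul]

theorem idem_inv_mul (a : S) : IsIdempotentElem (a⁻¹ * a) := by
  unfold IsIdempotentElem
  rw [← mul_assoc, InverseSemigroup.inv_mul_inv]

theorem idem_mul {e f : S} (he : IsIdempotentElem e) (hf : IsIdempotentElem f) :
    IsIdempotentElem (e * f) := by
  have h1 := InverseSemigroup.mul_inv_mul (e * f)
  have h2 := InverseSemigroup.inv_mul_inv (e * f)
  set x := (e * f)⁻¹ with hx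
  have he' : ∀ y, e * (e * y) = e * y := fun y => by rw [← mul_assoc, he.eq]
  have hf' : ∀ y, f * (f * y) = f * y := fun y => by rw [← mul_assoc, hf.eq]
  simp only [mul_assoc] at h1 h2
  have h3 : f * (x * e) = x := by
    refine InverseSemigroup.inv_unique (e * f) _ ?_ ?_
    · simp only [mul_assoc, he', hf']; exact h1
    · simp only [mul_assoc, he', hf']
      calc f * (x * (e * (f * (x * e)))) = f * (x * (e * (f * x))) * e := by
            simp only [mul_assoc]
        _ = f * (x * e) := by rw [h2, mul_assoc]
  have h4 : IsIdempotentElem x := by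
    unfold IsIdempotentElem
    have : x * (e * (f * (x * e))) = x * e := by
      calc x * (e * (f * (x * e))) = (x * (e * (f * x))) * e := by simp only [mul_assoc]
        _ = x * e := by rw [h2]
    calc x * x = (f * (x * e)) * (f * (x * e)) := by rw [h3]
      _ = f * (x * (e * (f * (x * e)))) := by simp only [mul_assoc]
      _ = f * (x * e) := by rw [this]
      _ = x := h3
  have h5 : e * f = x := by
    rw [← inv_inv' (e * f), ← hx, idem_inv h4]
  rw [h5]; exact h4

theorem idem_comm {e f : S} (he : IsIdempotentElem e) (hf : IsIdempotentElem f) :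
    e * f = f * e := by
  have h1 := idem_mul he hf
  have h2 := idem_mul hf he
  have he' : ∀ y, e * (e * y) = e * y := fun y => by rw [← mul_assoc, he.eq]
  have hf' : ∀ y, f * (f * y) = f * y := fun y => by rw [← mul_assoc, hf.eq]
  have := InverseSemigroup.inv_unique (e * f) (f * e) (by
    have := h1.eq
    simp only [mul_assoc, he', hf'] at this ⊢
    exact this) (by
    have := h2.eq
    simp only [mul_assoc, he', hf'] at this ⊢
    exact this)
  rw [this, idem_inv h1]

theorem mul_inv_rev' (a b : S) : (a * b)⁻¹ = b⁻¹ * a⁻¹ := by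
  have hc := idem_comm (idem_mul_inv b) (idem_inv_mul a)
  symm
  apply InverseSemigroup.inv_unique
  · calc a * b * (b⁻¹ * a⁻¹) * (a * b) = a * ((b * b⁻¹) * (a⁻¹ * a)) * b := by
          simp only [mul_assoc]
      _ = (a * a⁻¹ * a) * (b * b⁻¹ * b) := by rw [hc]; simp only [mul_assoc]
      _ = a * b := by rw [InverseSemigroup.mul_inv_mul, InverseSemigroup.mul_inv_mul]
  · calc b⁻¹ * a⁻¹ * (a * b) * (b⁻¹ * a⁻¹) = b⁻¹ * ((a⁻¹ * a) * (b * b⁻¹)) * a⁻¹ := by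
          simp only [mul_assoc]
      _ = (b⁻¹ * b * b⁻¹) * (a⁻¹ * a * a⁻¹) := by rw [← hc]; simp only [mul_assoc]
      _ = b⁻¹ * a⁻¹ := by rw [InverseSemigroup.inv_mul_inv, InverseSemigroup.inv_mul_inv]

theorem idem_conj (a : S) {e : S} (he : IsIdempotentElem e) : IsIdempotentElem (a⁻¹ * e * a) := by
  unfold IsIdempotentElem
  have hc := idem_comm he (idem_mul_inv a)
  calc a⁻¹ * e * a * (a⁻¹ * e * a) = a⁻¹ * (e * (a * a⁻¹)) * (e * a) := by simp only [mul_assoc]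
    _ = (a⁻¹ * a * a⁻¹) * (e * e) * a := by rw [hc]; simp only [mul_assoc]
    _ = a⁻¹ * e * a := by rw [he.eq, InverseSemigroup.inv_mul_inv]

theorem idem_mul_eq (a : S) {e : S} (he : IsIdempotentElem e) :
    e * a = a * (a⁻¹ * e * a) := by
  have hc := idem_comm he (idem_mul_inv a)
  calc e * a = e * (a * a⁻¹ * a) := by rw [InverseSemigroup.mul_inv_mul]
    _ = (e * (a * a⁻¹)) * a := by simp only [mul_assoc]
    _ = a * (a⁻¹ * e * a) := by rw [hc]; simp only [mul_assoc]

/-- The natural partial order: `a ≤ b` iff `a = b * e` for some idempotent `e`. -/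
instance natOrder : PartialOrder S where
  le a b := ∃ e : S, IsIdempotentElem e ∧ a = b * e
  le_refl a := ⟨a⁻¹ * a, idem_inv_mul a, by rw [← mul_assoc, InverseSemigroup.mul_inv_mul]⟩
  le_trans := by
    rintro a b c ⟨e, he, rfl⟩ ⟨f, hf, rfl⟩
    exact ⟨f * e, idem_mul hf he, by rw [mul_assoc]⟩
  le_antisymm := by
    rintro a b ⟨e, he, h1⟩ ⟨f, hf, h2⟩
    have h3 : b * e = b := by
      conv_lhs => rw [h2, mul_assoc, idem_comm hf he, ← mul_assoc]
      have : a * e = a := by rw [h1, mul_assoc, he.eq]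
      rw [this, ← h2]
    rw [h1, h3]

theorem le_def {a b : S} : a ≤ b ↔ ∃ e : S, IsIdempotentElem e ∧ a = b * e := Iff.rfl

theorem le_iff_mul_dom {a b : S} : a ≤ b ↔ a = b * (a⁻¹ * a) := by
  constructor
  · rintro ⟨e, he, rfl⟩
    rw [mul_inv_rev', idem_inv he]
    have hc := idem_comm he (idem_inv_mul b)
    calc b * e = (b * b⁻¹ * b) * (e * e) := by rw [he.eq, InverseSemigroup.mul_inv_mul]
      _ = b * ((b⁻¹ * b) * e) * e := by simp only [mul_assoc]
      _ = b * (e * b⁻¹ * (b * e)) := by rw [← hc]; simp only [mul_assoc]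
  · intro h
    exact ⟨_, idem_inv_mul a, h⟩

theorem le_of_idem_left {a e : S} (he : IsIdempotentElem e) : e * a ≤ a :=
  ⟨_, idem_conj a he, idem_mul_eq a he⟩

theorem le_of_idem_right {a e : S} (he : IsIdempotentElem e) : a * e ≤ a := ⟨e, he, rfl⟩

theorem inv_le {a b : S} (h : a ≤ b) : a⁻¹ ≤ b⁻¹ := by
  obtain ⟨e, he, rfl⟩ := h
  rw [mul_inv_rev', idem_inv he]
  exact le_of_idem_left he

theorem inv_le_iff {a b : S} : a⁻¹ ≤ b⁻¹ ↔ a ≤ b :=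
  ⟨fun h => by simpa only [inv_inv'] using inv_le h, inv_le⟩

theorem mul_le {a b c d : S} (h : a ≤ b) (h' : c ≤ d) : a * c ≤ b * d := by
  obtain ⟨e, he, rfl⟩ := h
  obtain ⟨f, hf, rfl⟩ := h'
  refine ⟨d⁻¹ * e * d * f, idem_mul (idem_conj d he) hf, ?_⟩
  calc b * e * (d * f) = b * (e * d) * f := by simp only [mul_assoc]
    _ = b * d * (d⁻¹ * e * d * f) := by rw [idem_mul_eq d he]; simp only [mul_assoc]

theorem idem_of_le {a e : S} (he : IsIdempotentElem e) (h : a ≤ e) : IsIdempotentElem a := by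
  obtain ⟨f, hf, rfl⟩ := h
  exact idem_mul he hf

end order

/-! ### Boolean inverse meet-semigroups and their proper morphisms -/

/-- Compatible elements. -/
def Compatible {S : Type u} [InverseSemigroup S] (a b : S) : Prop :=
  IsIdempotentElem (a⁻¹ * b) ∧ IsIdempotentElem (a * b⁻¹)

/-- A compatible subset: its elements are pairwise compatible. -/
def CompatibleSet {S : Type u} [InverseSemigroup S] (A : Set S) : Prop :=
  ∀ a ∈ A, ∀ b ∈ A, Compatible a b

/-- A partial order is a (generalized, i.e. not necessarily unital) Boolean algebra. -/
def IsBooleanAlgebraOrder (E : Type u) [LE E] : Prop :=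
  ∃ B : GeneralizedBooleanAlgebra E, ∀ x y : E, B.le x y ↔ x ≤ y

/-- A Boolean inverse meet-semigroup. Joins and meets are taken in the natural partial order. -/
structure IsBooleanInverseMeetSemigroup (S : Type u) [InverseSemigroupWithZero S] : Prop where
  exists_meet (a b : S) : ∃ c, IsGLB {a, b} c
  exists_join (A : Set S) : A.Finite → A.Nonempty → CompatibleSet A → ∃ j, IsLUB A j
  mul_join (A : Set S) : A.Finite → A.Nonempty → CompatibleSet A →
    ∀ c j, IsLUB A j → IsLUB ((fun a => c * a) '' A) (c * j)
  join_mul (A : Set S) : A.Finite → A.Nonempty → CompatibleSet A →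
    ∀ c j, IsLUB A j → IsLUB ((fun a => a * c) '' A) (j * c)
  boolean : IsBooleanAlgebraOrder (Idem S)

/-- A filter in an inverse semigroup with zero: a nonempty, down directed, upwards closed subset
that does not contain zero. -/
structure IsFilter {S : Type u} [InverseSemigroupWithZero S] (F : Set S) : Prop where
  nonempty : F.Nonempty
  directed (x y : S) : x ∈ F → y ∈ F → ∃ z ∈ F, z ≤ x ∧ z ≤ y
  closed (x y : S) : x ∈ F → x ≤ y → y ∈ F
  zero_notMem : (0 : S) ∉ F

/-- An ultrafilter is a maximal filter. -/
def IsUltra {S : Type u} [InverseSemigroupWithZero S] (F : Set S) : Prop :=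
  Maximal IsFilter F

/-- The restriction of a semigroup homomorphism to the idempotents. -/
def idemMap {S T : Type u} [Semigroup S] [Semigroup T] (f : S →ₙ* T) (e : Idem S) : Idem T :=
  ⟨f e.1, e.2.map f⟩

/-- A proper morphism of Boolean inverse meet-semigroups: a semigroup homomorphism which preserves
binary meets, whose restriction to the idempotents is a homomorphism of Boolean algebras
(it preserves zero and binary meets and joins), and for which inverse images of ultrafilters are
ultrafilters. -/
@[ext]
structure ProperMorphism (S T : Type u) [InverseSemigroupWithZero S] [InverseSemigroupWithZero T]
    extends S →ₙ* T where
  map_meet (a b c : S) : IsGLB {a, b} c → IsGLB {toFun a, toFun b} (toFun c)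
  map_zero : toFun 0 = 0
  map_idem_meet (e f g : Idem S) : IsGLB {e, f} g →
    IsGLB {idemMap toMulHom e, idemMap toMulHom f} (idemMap toMulHom g)
  map_idem_join (e f g : Idem S) : IsLUB {e, f} g →
    IsLUB {idemMap toMulHom e, idemMap toMulHom f} (idemMap toMulHom g)
  proper (F : Set T) : IsUltra F → IsUltra (toFun ⁻¹' F)

/-- Bundled Boolean inverse meet-semigroups. -/
structure BooleanInverseMeetSemigroupCat : Type (u + 1) where
  carrier : Type u
  [str : InverseSemigroupWithZero carrier]
  isBoolean : IsBooleanInverseMeetSemigroup carrier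

attribute [instance] BooleanInverseMeetSemigroupCat.str

instance : CoeSort BooleanInverseMeetSemigroupCat.{u} (Type u) :=
  ⟨BooleanInverseMeetSemigroupCat.carrier⟩

/-- The category of Boolean inverse meet-semigroups and proper morphisms. -/
instance : Category BooleanInverseMeetSemigroupCat.{u} where
  Hom S T := ProperMorphism S T
  id S :=
    { MulHom.id S with
      map_meet := fun _ _ _ h => h
      map_zero := rfl
      map_idem_meet := fun _ _ _ h => h
      map_idem_join := fun _ _ _ h => h
      proper := fun _ h => h }
  comp f g :=
    { g.toMulHom.comp f.toMulHom with
      map_meet := fun _ _ _ h => g.map_meet _ _ _ (f.map_meet _ _ _ h)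
      map_zero := (congrArg g.toFun f.map_zero).trans g.map_zero
      map_idem_meet := fun _ _ _ h => g.map_idem_meet _ _ _ (f.map_idem_meet _ _ _ h)
      map_idem_join := fun _ _ _ h => g.map_idem_join _ _ _ (f.map_idem_join _ _ _ h)
      proper := fun F h => f.proper _ (g.proper F h) }

/-! ### Hausdorff Boolean groupoids and their proper continuous covering functors -/

/-- A small groupoid, given by its set `G` of arrows, with objects replaced by identities. The
product `comp g h w` is defined when `dom g = cod h`. -/
class ArrowGroupoid (G : Type u) where
  dom : G → G
  cod : G → G
  inv : G → G
  comp (g h : G) : dom g = cod h → G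
  dom_dom (g : G) : dom (dom g) = dom g
  cod_dom (g : G) : cod (dom g) = dom g
  dom_cod (g : G) : dom (cod g) = cod g
  cod_cod (g : G) : cod (cod g) = cod g
  dom_comp (g h : G) (w : dom g = cod h) : dom (comp g h w) = dom h
  cod_comp (g h : G) (w : dom g = cod h) : cod (comp g h w) = cod g
  comp_assoc (g h k : G) (w : dom g = cod h) (w' : dom h = cod k) :
    comp (comp g h w) k ((dom_comp g h w).trans w') =
      comp g (comp h k w') (w.trans (cod_comp h k w').symm)
  comp_dom (g : G) : comp g (dom g) (cod_dom g).symm = g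
  cod_comp_self (g : G) : comp (cod g) g (dom_cod g) = g
  dom_inv (g : G) : dom (inv g) = cod g
  cod_inv (g : G) : cod (inv g) = dom g
  inv_comp (g : G) : comp (inv g) g (dom_inv g) = dom g
  comp_inv (g : G) : comp g (inv g) (cod_inv g).symm = cod g

namespace ArrowGroupoid

/-- The set of identities of a groupoid. -/
def identities (G : Type u) [ArrowGroupoid G] : Set G := {e | dom e = e}

variable {G : Type u} [ArrowGroupoid G]

/-- The domain map as a map into the identities. -/
def domId (g : G) : identities G := ⟨dom g, dom_dom g⟩

/-- The product of two subsets of a groupoid. -/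
def setMul (A B : Set G) : Set G :=
  {x | ∃ g ∈ A, ∃ h ∈ B, ∃ w : dom g = cod h, x = comp g h w}

/-- The set of inverses of the elements of a subset. -/
def setInv (A : Set G) : Set G := inv '' A

/-- Local bisections: `A⁻¹A` and `AA⁻¹` consist of identities. -/
def IsLocalBisection (A : Set G) : Prop :=
  setMul (setInv A) A ⊆ identities G ∧ setMul A (setInv A) ⊆ identities G

end ArrowGroupoid

open ArrowGroupoid

/-- A Boolean space: a Hausdorff space with a basis of compact-open sets. -/
structure IsBooleanSpace (X : Type u) [TopologicalSpace X] : Prop where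
  t2 : T2Space X
  basis : TopologicalSpace.IsTopologicalBasis {U : Set X | IsOpen U ∧ IsCompact U}

/-- A Hausdorff Boolean groupoid: a Hausdorff étale topological groupoid with a basis of
compact-open local bisections, whose space of identities is a Boolean space. -/
structure IsHausdorffBooleanGroupoid (G : Type u) [ArrowGroupoid G] [TopologicalSpace G] :
    Prop where
  continuous_inv : Continuous (inv : G → G)
  continuous_comp :
    Continuous fun p : {p : G × G // dom p.1 = cod p.2} => comp p.1.1 p.1.2 p.2
  etale : IsLocalHomeomorph (domId : G → identities G)
  basis : TopologicalSpace.IsTopologicalBasis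
    {U : Set G | IsOpen U ∧ IsCompact U ∧ IsLocalBisection U}
  identities_boolean : IsBooleanSpace (identities G)
  t2 : T2Space G

/-- A proper continuous covering functor between topological groupoids. -/
@[ext]
structure ProperCoveringFunctor (G H : Type u) [ArrowGroupoid G] [ArrowGroupoid H]
    [TopologicalSpace G] [TopologicalSpace H] where
  toFun : G → H
  map_dom (g : G) : toFun (dom g) = dom (toFun g)
  map_cod (g : G) : toFun (cod g) = cod (toFun g)
  map_comp (g h : G) (w : dom g = cod h) : toFun (comp g h w) =
    comp (toFun g) (toFun h) (((map_dom g).symm.trans (congrArg toFun w)).trans (map_cod h))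
  star_injective (g g' : G) : toFun g = toFun g' → dom g = dom g' → g = g'
  star_surjective (e : G) (h : H) : e ∈ identities G → dom h = toFun e →
    ∃ g, dom g = e ∧ toFun g = h
  continuous : Continuous toFun
  proper (K : Set H) : IsCompact K → IsCompact (toFun ⁻¹' K)

/-- Bundled Hausdorff Boolean groupoids. -/
structure HausdorffBooleanGroupoidCat : Type (u + 1) where
  carrier : Type u
  [grp : ArrowGroupoid carrier]
  [top : TopologicalSpace carrier]
  isBoolean : IsHausdorffBooleanGroupoid carrier

attribute [instance] HausdorffBooleanGroupoidCat.grp HausdorffBooleanGroupoidCat.top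

instance : CoeSort HausdorffBooleanGroupoidCat.{u} (Type u) :=
  ⟨HausdorffBooleanGroupoidCat.carrier⟩

/-- The category of Hausdorff Boolean groupoids and proper continuous covering functors. -/
instance : Category HausdorffBooleanGroupoidCat.{u} where
  Hom G H := ProperCoveringFunctor G H
  id G :=
    { toFun := fun g => g
      map_dom := fun _ => rfl
      map_cod := fun _ => rfl
      map_comp := fun _ _ _ => rfl
      star_injective := fun _ _ h _ => h
      star_surjective := fun _ h _ w => ⟨h, w, rfl⟩
      continuous := continuous_id
      proper := fun _ h => h }
  comp α β :=
    { toFun := fun g => β.toFun (α.toFun g)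
      map_dom := fun g => by rw [α.map_dom, β.map_dom]
      map_cod := fun g => by rw [α.map_cod, β.map_cod]
      map_comp := fun g h w => by rw [← β.map_comp]; congr 1; exact α.map_comp g h w
      star_injective := fun g g' h w => α.star_injective g g'
        (β.star_injective _ _ h (by rw [← α.map_dom, ← α.map_dom, w])) w
      star_surjective := fun e h he w => by
        obtain ⟨k, hk, rfl⟩ := β.star_surjective (α.toFun e) h
          (by change dom _ = _; rw [← α.map_dom]; exact congrArg _ he) w
        obtain ⟨g, hg, rfl⟩ := α.star_surjective e k he hk
        exact ⟨g, hg, rfl⟩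
      continuous := β.continuous.comp α.continuous
      proper := fun K hK => α.proper _ (β.proper K hK) }

/-! ### The groupoid of ultrafilters -/

section filters

variable {S : Type u} [InverseSemigroupWithZero S]

/-- The product of filters: `A · B = (AB)↑`. -/
def filterMul (A B : Set S) : Set S := {x | ∃ a ∈ A, ∃ b ∈ B, a * b ≤ x}

/-- `A⁻¹`, the set of inverses of elements of `A`. -/
def filterInv (A : Set S) : Set S := (fun a => a⁻¹) '' A

theorem mem_filterInv {A : Set S} {x : S} : x ∈ filterInv A ↔ x⁻¹ ∈ A := by
  constructor
  · rintro ⟨a, ha, rfl⟩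
    change a⁻¹⁻¹ ∈ A
    rwa [inv_inv']
  · intro h
    exact ⟨_, h, inv_inv' x⟩

theorem filterInv_inv (A : Set S) : filterInv (filterInv A) = A := by
  ext x
  rw [mem_filterInv, mem_filterInv, inv_inv']

theorem filterMul_assoc (A B C : Set S) :
    filterMul (filterMul A B) C = filterMul A (filterMul B C) := by
  ext x
  constructor
  · rintro ⟨y, ⟨a, ha, b, hb, h⟩, c, hc, h'⟩
    exact ⟨a, ha, b * c, ⟨b, hb, c, hc, le_rfl⟩,
      (by rw [← mul_assoc]; exact mul_le h le_rfl : a * (b * c) ≤ y * c).trans h'⟩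
  · rintro ⟨a, ha, y, ⟨b, hb, c, hc, h⟩, h'⟩
    exact ⟨a * b, ⟨a, ha, b, hb, le_rfl⟩, c, hc,
      (by rw [mul_assoc]; exact mul_le le_rfl h : a * b * c ≤ a * y).trans h'⟩

theorem filterInv_mul (A B : Set S) :
    filterInv (filterMul A B) = filterMul (filterInv B) (filterInv A) := by
  ext x
  rw [mem_filterInv]
  constructor
  · rintro ⟨a, ha, b, hb, h⟩
    refine ⟨_, ⟨b, hb, rfl⟩, _, ⟨a, ha, rfl⟩, ?_⟩
    have := inv_le h
    rwa [inv_inv', mul_inv_rev'] at this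
  · rintro ⟨_, ⟨b, hb, rfl⟩, _, ⟨a, ha, rfl⟩, h⟩
    refine ⟨a, ha, b, hb, ?_⟩
    rw [← inv_le_iff, inv_inv', mul_inv_rev']
    exact h

theorem filterMul_inv_mul {A : Set S} (hA : IsFilter A) :
    filterMul (filterMul A (filterInv A)) A = A := by
  ext x
  constructor
  · rintro ⟨y, ⟨a, ha, _, ⟨b, hb, rfl⟩, h⟩, c, hc, h'⟩
    obtain ⟨z, hz, hza, hzb⟩ := hA.directed a b ha hb
    obtain ⟨w, hw, hwz, hwc⟩ := hA.directed z c hz hc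
    refine hA.closed w x hw ?_
    calc w = w * w⁻¹ * w := (InverseSemigroup.mul_inv_mul w).symm
      _ ≤ a * b⁻¹ * c := mul_le (mul_le (hwz.trans hza) (inv_le (hwz.trans hzb))) hwc
      _ ≤ y * c := mul_le h le_rfl
      _ ≤ x := h'
  · intro hx
    exact ⟨x * x⁻¹, ⟨x, hx, _, ⟨x, hx, rfl⟩, le_rfl⟩, x, hx,
      (InverseSemigroup.mul_inv_mul x).le⟩

theorem isFilter_inv {A : Set S} (hA : IsFilter A) : IsFilter (filterInv A) where
  nonempty := hA.nonempty.image _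
  directed x y hx hy := by
    rw [mem_filterInv] at hx hy
    obtain ⟨z, hz, h1, h2⟩ := hA.directed _ _ hx hy
    exact ⟨z⁻¹, ⟨z, hz, rfl⟩, by rw [← inv_le_iff, inv_inv']; exact h1,
      by rw [← inv_le_iff, inv_inv']; exact h2⟩
  closed x y hx h := by
    rw [mem_filterInv] at hx ⊢
    exact hA.closed _ _ hx (inv_le h)
  zero_notMem h := by
    rw [mem_filterInv] at h
    refine hA.zero_notMem ?_
    rwa [idem_inv (InverseSemigroupWithZero.zero_mul' (0 : S))] at h

theorem filterInv_mono {A B : Set S} (h : A ⊆ B) : filterInv A ⊆ filterInv B := Set.image_mono h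

theorem isUltra_inv {A : Set S} (hA : IsUltra A) : IsUltra (filterInv A) := by
  refine ⟨isFilter_inv hA.1, fun F hF h => ?_⟩
  have h1 : A ⊆ filterInv F := by
    have := filterInv_mono h
    rwa [filterInv_inv] at this
  have h2 := filterInv_mono (hA.2 (isFilter_inv hF) h1)
  rwa [filterInv_inv] at h2

theorem le_zero_iff {a : S} : a ≤ 0 ↔ a = 0 := by
  constructor
  · rintro ⟨e, -, rfl⟩
    exact InverseSemigroupWithZero.zero_mul' e
  · rintro rfl; exact le_rfl

theorem zero_le' (a : S) : 0 ≤ a :=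
  ⟨0, InverseSemigroupWithZero.zero_mul' 0, (InverseSemigroupWithZero.mul_zero' a).symm⟩

/-- Auxiliary: in a filter, idempotents have nonzero products. -/
theorem idem_mul_ne_zero {E : Set S} (hE : IsFilter E) {e f : S} (he : IsIdempotentElem e)
    (h1 : e ∈ E) (h2 : f ∈ E) : e * f ≠ 0 := by
  intro h
  obtain ⟨z, hz, hze, hzf⟩ := hE.directed e f h1 h2
  have h3 : z * z ≤ e * f := mul_le hze hzf
  rw [(idem_of_le he hze).eq, h, le_zero_iff] at h3
  exact hE.zero_notMem (h3 ▸ hz)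

theorem isFilter_dom {A : Set S} (hA : IsFilter A) : IsFilter (filterMul (filterInv A) A) where
  nonempty := by
    obtain ⟨a, ha⟩ := hA.nonempty
    exact ⟨_, a⁻¹, ⟨a, ha, rfl⟩, a, ha, le_rfl⟩
  directed := by
    rintro x y ⟨_, ⟨a, ha, rfl⟩, b, hb, h⟩ ⟨_, ⟨c, hc, rfl⟩, d, hd, h'⟩
    obtain ⟨z, hz, hza, hzc⟩ := hA.directed a c ha hc
    obtain ⟨w, hw, hwb, hwd⟩ := hA.directed b d hb hd
    exact ⟨z⁻¹ * w, ⟨_, ⟨z, hz, rfl⟩, w, hw, le_rfl⟩, (mul_le (inv_le hza) hwb).trans h,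
      (mul_le (inv_le hzc) hwd).trans h'⟩
  closed := by
    rintro x y ⟨a, ha, b, hb, h⟩ h'
    exact ⟨a, ha, b, hb, h.trans h'⟩
  zero_notMem := by
    rintro ⟨_, ⟨a, ha, rfl⟩, b, hb, h⟩
    obtain ⟨z, hz, hza, hzb⟩ := hA.directed a b ha hb
    have h1 : z⁻¹ * z ≤ 0 := (mul_le (inv_le hza) hzb).trans h
    rw [le_zero_iff] at h1
    have h2 := InverseSemigroup.mul_inv_mul z
    rw [mul_assoc, h1, InverseSemigroupWithZero.mul_zero'] at h2
    exact hA.zero_notMem (h2 ▸ hz)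

theorem isUltra_mul {A B : Set S} (hA : IsUltra A) (hB : IsUltra B)
    (hAB : filterMul (filterInv A) A = filterMul B (filterInv B)) : IsUltra (filterMul A B) := by
  have hE := isFilter_dom hA.1
  refine ⟨⟨?_, ?_, ?_, ?_⟩, ?_⟩
  · obtain ⟨a, ha⟩ := hA.1.nonempty
    obtain ⟨b, hb⟩ := hB.1.nonempty
    exact ⟨_, a, ha, b, hb, le_rfl⟩
  · rintro x y ⟨a, ha, b, hb, h⟩ ⟨c, hc, d, hd, h'⟩
    obtain ⟨z, hz, hza, hzc⟩ := hA.1.directed a c ha hc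
    obtain ⟨w, hw, hwb, hwd⟩ := hB.1.directed b d hb hd
    exact ⟨z * w, ⟨z, hz, w, hw, le_rfl⟩, (mul_le hza hwb).trans h, (mul_le hzc hwd).trans h'⟩
  · rintro x y ⟨a, ha, b, hb, h⟩ h'
    exact ⟨a, ha, b, hb, h.trans h'⟩
  · rintro ⟨a, ha, b, hb, h⟩
    rw [le_zero_iff] at h
    have h1 : a⁻¹ * a ∈ filterMul (filterInv A) A := ⟨_, ⟨a, ha, rfl⟩, a, ha, le_rfl⟩
    have h2 : b * b⁻¹ ∈ filterMul (filterInv A) A := by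
      rw [hAB]; exact ⟨b, hb, _, ⟨b, hb, rfl⟩, le_rfl⟩
    refine idem_mul_ne_zero hE (idem_inv_mul a) h1 h2 ?_
    calc a⁻¹ * a * (b * b⁻¹) = a⁻¹ * (a * b) * b⁻¹ := by simp only [mul_assoc]
      _ = 0 := by rw [h, InverseSemigroupWithZero.mul_zero', InverseSemigroupWithZero.zero_mul']
  · intro F hF hCF
    obtain ⟨a, ha⟩ := hA.1.nonempty
    obtain ⟨b₀, hb₀⟩ := hB.1.nonempty
    have hD : IsFilter {x | ∃ f ∈ F, a⁻¹ * f ≤ x} := by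
      refine ⟨?_, ?_, ?_, ?_⟩
      · obtain ⟨f, hf⟩ := hF.nonempty
        exact ⟨_, f, hf, le_rfl⟩
      · rintro x y ⟨f, hf, h⟩ ⟨g, hg, h'⟩
        obtain ⟨z, hz, hzf, hzg⟩ := hF.directed f g hf hg
        exact ⟨_, ⟨z, hz, le_rfl⟩, (mul_le le_rfl hzf).trans h, (mul_le le_rfl hzg).trans h'⟩
      · rintro x y ⟨f, hf, h⟩ h'
        exact ⟨f, hf, h.trans h'⟩
      · rintro ⟨f, hf, h⟩
        obtain ⟨z, hz, hzf, e, he, hze⟩ := hF.directed f (a * b₀) hf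
          (hCF ⟨a, ha, b₀, hb₀, le_rfl⟩)
        have h1 : a⁻¹ * z ≤ 0 := (mul_le le_rfl hzf).trans h
        rw [le_zero_iff] at h1
        have h2 : a * (a⁻¹ * z) = z := by
          rw [hze]
          calc a * (a⁻¹ * (a * b₀ * e)) = (a * a⁻¹ * a) * b₀ * e := by simp only [mul_assoc]
            _ = a * b₀ * e := by rw [InverseSemigroup.mul_inv_mul]
        rw [h1, InverseSemigroupWithZero.mul_zero'] at h2
        exact hF.zero_notMem (h2 ▸ hz)
    have hBD : B ⊆ {x | ∃ f ∈ F, a⁻¹ * f ≤ x} := by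
      intro b hb
      have h1 : b * b⁻¹ ∈ filterMul (filterInv A) A := by
        rw [hAB]; exact ⟨b, hb, _, ⟨b, hb, rfl⟩, le_rfl⟩
      obtain ⟨_, ⟨a', ha', rfl⟩, a'', ha'', h⟩ := h1
      obtain ⟨z, hz, hza', hza''⟩ := hA.1.directed a' a'' ha' ha''
      obtain ⟨w, hw, hwz, hwa⟩ := hA.1.directed z a hz ha
      refine ⟨w * b, hCF ⟨w, hw, b, hb, le_rfl⟩, ?_⟩
      have h3 : a⁻¹ * w = w⁻¹ * w := by
        obtain ⟨e, he, rfl⟩ := hwa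
        rw [mul_inv_rev', idem_inv he]
        have hc := idem_comm he (idem_inv_mul a)
        calc a⁻¹ * (a * e) = (a⁻¹ * a) * (e * e) := by rw [he.eq, mul_assoc]
          _ = (a⁻¹ * a) * e * e := by simp only [mul_assoc]
          _ = e * a⁻¹ * (a * e) := by rw [← hc]; simp only [mul_assoc]
      rw [← mul_assoc, h3]
      calc w⁻¹ * w * b ≤ a'⁻¹ * a'' * b :=
            mul_le (mul_le (inv_le (hwz.trans hza')) (hwz.trans hza'')) le_rfl
        _ ≤ b * b⁻¹ * b := mul_le h le_rfl
        _ = b := InverseSemigroup.mul_inv_mul b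
    intro f hf
    have h4 : a⁻¹ * f ∈ B := hB.2 hD hBD ⟨f, hf, le_rfl⟩
    refine ⟨a, ha, _, h4, ?_⟩
    rw [← mul_assoc]
    exact le_of_idem_left (idem_mul_inv a)

end filters

/-- The set of ultrafilters of `S`. -/
@[ext]
structure UltrafilterGroupoid (S : Type u) [InverseSemigroupWithZero S] : Type u where
  carrier : Set S
  isUltra : IsUltra carrier

/-- The groupoid of ultrafilters: the domain of `A` is `A⁻¹ · A`, the codomain is `A · A⁻¹`, and
the composite is the product `A · B` of filters, when `A⁻¹ · A = B · B⁻¹`. -/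
instance (S : Type u) [InverseSemigroupWithZero S] : ArrowGroupoid (UltrafilterGroupoid S) where
  dom A := ⟨filterMul (filterInv A.1) A.1,
    isUltra_mul (isUltra_inv A.2) A.2 (by rw [filterInv_inv])⟩
  cod A := ⟨filterMul A.1 (filterInv A.1),
    isUltra_mul A.2 (isUltra_inv A.2) (by rw [filterInv_inv])⟩
  inv A := ⟨filterInv A.1, isUltra_inv A.2⟩
  comp A B w := ⟨filterMul A.1 B.1, isUltra_mul A.2 B.2 (congrArg UltrafilterGroupoid.carrier w)⟩
  dom_dom A := UltrafilterGroupoid.ext <| by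
    change filterMul (filterInv (filterMul (filterInv A.1) A.1)) (filterMul (filterInv A.1) A.1) =
      filterMul (filterInv A.1) A.1
    rw [filterInv_mul, filterInv_inv, filterMul_assoc, ← filterMul_assoc A.1,
      filterMul_inv_mul A.2.1]
  cod_dom A := UltrafilterGroupoid.ext <| by
    change filterMul (filterMul (filterInv A.1) A.1) (filterInv (filterMul (filterInv A.1) A.1)) =
      filterMul (filterInv A.1) A.1
    rw [filterInv_mul, filterInv_inv, filterMul_assoc, ← filterMul_assoc A.1,
      filterMul_inv_mul A.2.1]
  dom_cod A := UltrafilterGroupoid.ext <| by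
    change filterMul (filterInv (filterMul A.1 (filterInv A.1))) (filterMul A.1 (filterInv A.1)) =
      filterMul A.1 (filterInv A.1)
    rw [filterInv_mul, filterInv_inv, ← filterMul_assoc, filterMul_inv_mul A.2.1]
  cod_cod A := UltrafilterGroupoid.ext <| by
    change filterMul (filterMul A.1 (filterInv A.1)) (filterInv (filterMul A.1 (filterInv A.1))) =
      filterMul A.1 (filterInv A.1)
    rw [filterInv_mul, filterInv_inv, ← filterMul_assoc, filterMul_inv_mul A.2.1]
  dom_comp A B w := UltrafilterGroupoid.ext <| by
    have w' : filterMul (filterInv A.1) A.1 = filterMul B.1 (filterInv B.1) :=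
      congrArg UltrafilterGroupoid.carrier w
    change filterMul (filterInv (filterMul A.1 B.1)) (filterMul A.1 B.1) =
      filterMul (filterInv B.1) B.1
    rw [filterInv_mul, filterMul_assoc, ← filterMul_assoc (filterInv A.1), w',
      filterMul_inv_mul B.2.1]
  cod_comp A B w := UltrafilterGroupoid.ext <| by
    have w' : filterMul (filterInv A.1) A.1 = filterMul B.1 (filterInv B.1) :=
      congrArg UltrafilterGroupoid.carrier w
    change filterMul (filterMul A.1 B.1) (filterInv (filterMul A.1 B.1)) =
      filterMul A.1 (filterInv A.1)
    rw [filterInv_mul, filterMul_assoc, ← filterMul_assoc B.1, ← w', filterMul_assoc,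
      ← filterMul_assoc A.1, ← filterMul_assoc, filterMul_inv_mul A.2.1]
  comp_assoc A B C w w' := UltrafilterGroupoid.ext (filterMul_assoc _ _ _)
  comp_dom A := UltrafilterGroupoid.ext <| by
    change filterMul A.1 (filterMul (filterInv A.1) A.1) = A.1
    rw [← filterMul_assoc, filterMul_inv_mul A.2.1]
  cod_comp_self A := UltrafilterGroupoid.ext (filterMul_inv_mul A.2.1)
  dom_inv A := UltrafilterGroupoid.ext <| by
    change filterMul (filterInv (filterInv A.1)) (filterInv A.1) = filterMul A.1 (filterInv A.1)
    rw [filterInv_inv]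
  cod_inv A := UltrafilterGroupoid.ext <| by
    change filterMul (filterInv A.1) (filterInv (filterInv A.1)) = filterMul (filterInv A.1) A.1
    rw [filterInv_inv]
  inv_comp A := rfl
  comp_inv A := rfl

/-- `V a` is the set of ultrafilters which contain `a`. -/
def V {S : Type u} [InverseSemigroupWithZero S] (a : S) : Set (UltrafilterGroupoid S) :=
  {A | a ∈ A.1}

/-- The topology on the groupoid of ultrafilters which is generated by the sets `V a`. -/
instance (S : Type u) [InverseSemigroupWithZero S] : TopologicalSpace (UltrafilterGroupoid S) :=
  TopologicalSpace.generateFrom (Set.range V)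

section spectrum

variable {S : Type u} [InverseSemigroupWithZero S]

theorem isOpen_V (a : S) : IsOpen (V a) :=
  TopologicalSpace.isOpen_generateFrom_of_mem ⟨a, rfl⟩

theorem ultra_dom_mem {A : UltrafilterGroupoid S} {a : S} (h : a ∈ A.1) :
    a⁻¹ * a ∈ (dom A).1 := ⟨_, ⟨a, h, rfl⟩, a, h, le_rfl⟩

theorem ultra_cod_mem {A : UltrafilterGroupoid S} {a : S} (h : a ∈ A.1) :
    a * a⁻¹ ∈ (cod A).1 := ⟨a, h, _, ⟨a, h, rfl⟩, le_rfl⟩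

theorem ultra_eq_of_subset {A B : UltrafilterGroupoid S} (h : A.1 ⊆ B.1) : A = B :=
  UltrafilterGroupoid.ext (h.antisymm (A.2.2 B.2.1 h))

/-- An ultrafilter is determined by its domain and one of its elements. -/
theorem ultra_eq_of_dom {A B : UltrafilterGroupoid S} {a : S} (hA : a ∈ A.1) (hB : a ∈ B.1)
    (h : dom A = dom B) : A = B := by
  apply ultra_eq_of_subset
  intro x hx
  have h1 : a⁻¹ * x ∈ (dom A).1 := ⟨_, ⟨a, hA, rfl⟩, x, hx, le_rfl⟩
  rw [h] at h1
  have h2 := comp_dom B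
  rw [← h2]
  refine ⟨a, hB, _, h1, ?_⟩
  rw [← mul_assoc]
  exact le_of_idem_left (idem_mul_inv a)

theorem inv_inv_eq {G : Type u} [ArrowGroupoid G] (g : G) : inv (inv g) = g := by
  have h1 : dom (inv (inv g)) = cod (inv g) := dom_inv _
  have h2 := comp_assoc (inv (inv g)) (inv g) g h1 (dom_inv g)
  have h3 : comp (inv (inv g)) (inv g) h1 = dom (inv g) := inv_comp _
  have h4 : dom (inv g) = cod g := dom_inv g
  have e1 : comp (comp (inv (inv g)) (inv g) h1) g
      ((dom_comp (inv (inv g)) (inv g) h1).trans (dom_inv g)) = g := by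
    have : ∀ x (hx : x = cod g) (w : dom x = cod g), comp x g w = g := by
      rintro x rfl w; exact cod_comp_self g
    exact this _ (h3.trans h4) _
  have e2 : comp (inv (inv g)) (comp (inv g) g (dom_inv g))
      (h1.trans (cod_comp (inv g) g (dom_inv g)).symm) = inv (inv g) := by
    have : ∀ x (hx : x = dom (inv (inv g))) (w : dom (inv (inv g)) = cod x),
        comp (inv (inv g)) x w = inv (inv g) := by
      rintro x rfl w; exact comp_dom _
    refine this _ ?_ _
    rw [inv_comp, h1, cod_inv]
  rw [e1, e2] at h2
  exact h2.symm

theorem ultra_eq_of_cod {A B : UltrafilterGroupoid S} {a : S} (hA : a ∈ A.1) (hB : a ∈ B.1)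
    (h : cod A = cod B) : A = B := by
  have h1 : inv A = inv B := ultra_eq_of_dom (a := a⁻¹) ⟨a, hA, rfl⟩ ⟨a, hB, rfl⟩
    (by rw [dom_inv, dom_inv, h])
  rw [← inv_inv_eq A, h1, inv_inv_eq]

/-- A subset on which the domain and codomain maps are injective is a bisection. -/
theorem isLocalBisection_of {G : Type u} [ArrowGroupoid G] {A : Set G}
    (h1 : ∀ g ∈ A, ∀ h ∈ A, dom g = dom h → g = h)
    (h2 : ∀ g ∈ A, ∀ h ∈ A, cod g = cod h → g = h) : IsLocalBisection A := by
  constructor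
  · rintro _ ⟨_, ⟨g, hg, rfl⟩, h, hh, w, rfl⟩
    obtain rfl := h2 g hg h hh (by rw [← w, dom_inv])
    rw [inv_comp]
    exact dom_dom g
  · rintro _ ⟨g, hg, _, ⟨h, hh, rfl⟩, w, rfl⟩
    obtain rfl := h1 g hg h hh (by rw [w, cod_inv])
    rw [comp_inv]
    exact dom_cod g

theorem isLocalBisection_V (a : S) : IsLocalBisection (V a) :=
  isLocalBisection_of (fun _ hA _ hB h => ultra_eq_of_dom hA hB h)
    (fun _ hA _ hB h => ultra_eq_of_cod hA hB h)

theorem ultra_exists_of_notMem (hS : IsBooleanInverseMeetSemigroup S) {A : UltrafilterGroupoid S}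
    {x : S} (hx : x ∉ A.1) : ∃ b ∈ A.1, ∀ y, y ≤ b → y ≤ x → y = 0 := by
  by_contra hcon
  push Not at hcon
  have hF : IsFilter {z | ∃ b ∈ A.1, ∃ m, IsGLB {b, x} m ∧ m ≤ z} := by
    refine ⟨?_, ?_, ?_, ?_⟩
    · obtain ⟨b, hb⟩ := A.2.1.nonempty
      obtain ⟨m, hm⟩ := hS.exists_meet b x
      exact ⟨m, b, hb, m, hm, le_rfl⟩
    · rintro z w ⟨b, hb, m, hm, h⟩ ⟨b', hb', m', hm', h'⟩
      obtain ⟨c, hc, hcb, hcb'⟩ := A.2.1.directed b b' hb hb'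
      obtain ⟨n, hn⟩ := hS.exists_meet c x
      have h1 : n ≤ c := hn.1 (by simp)
      have h2 : n ≤ x := hn.1 (by simp)
      refine ⟨n, ⟨c, hc, n, hn, le_rfl⟩, le_trans (hm.2 ?_) h, le_trans (hm'.2 ?_) h'⟩
      · rintro y (rfl | rfl)
        exacts [h1.trans hcb, h2]
      · rintro y (rfl | rfl)
        exacts [h1.trans hcb', h2]
    · rintro z w ⟨b, hb, m, hm, h⟩ h'
      exact ⟨b, hb, m, hm, h.trans h'⟩
    · rintro ⟨b, hb, m, hm, h⟩
      obtain ⟨y, hyb, hyx, hy⟩ := hcon b hb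
      refine hy (le_zero_iff.1 (le_trans (hm.2 ?_) h))
      rintro z (rfl | rfl)
      exacts [hyb, hyx]
  have h1 : A.1 ⊆ {z | ∃ b ∈ A.1, ∃ m, IsGLB {b, x} m ∧ m ≤ z} := by
    intro b hb
    obtain ⟨m, hm⟩ := hS.exists_meet b x
    exact ⟨b, hb, m, hm, hm.1 (by simp)⟩
  refine hx (A.2.2 hF h1 ?_)
  obtain ⟨b, hb⟩ := A.2.1.nonempty
  obtain ⟨m, hm⟩ := hS.exists_meet b x
  exact ⟨b, hb, m, hm, hm.1 (by simp)⟩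

theorem isTopologicalBasis_V :
    TopologicalSpace.IsTopologicalBasis (Set.range (V : S → Set (UltrafilterGroupoid S))) where
  exists_subset_inter := by
    rintro _ ⟨a, rfl⟩ _ ⟨b, rfl⟩ A ⟨ha, hb⟩
    obtain ⟨c, hc, h1, h2⟩ := A.2.1.directed a b ha hb
    exact ⟨V c, ⟨c, rfl⟩, hc, fun B hB => ⟨B.2.1.closed _ _ hB h1, B.2.1.closed _ _ hB h2⟩⟩
  sUnion_eq := by
    ext A
    simp only [Set.mem_sUnion, Set.mem_univ, iff_true]
    obtain ⟨a, ha⟩ := A.2.1.nonempty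
    exact ⟨V a, ⟨a, rfl⟩, ha⟩
  eq_generateFrom := rfl

theorem t2_ultra (hS : IsBooleanInverseMeetSemigroup S) : T2Space (UltrafilterGroupoid S) := by
  refine ⟨fun A B hAB => ?_⟩
  have : ∃ a ∈ A.1, a ∉ B.1 := by
    by_contra h
    push Not at h
    exact hAB (ultra_eq_of_subset h)
  obtain ⟨a, ha, haB⟩ := this
  obtain ⟨b, hb, h⟩ := ultra_exists_of_notMem hS haB
  refine ⟨V a, V b, isOpen_V a, isOpen_V b, ha, hb, ?_⟩
  rw [Set.disjoint_left]
  intro C hC hC'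
  obtain ⟨c, hc, h1, h2⟩ := C.2.1.directed a b hC hC'
  exact C.2.1.zero_notMem (h c h2 h1 ▸ hc)

theorem idem_inf {e f : S} (he : IsIdempotentElem e) (hf : IsIdempotentElem f) :
    e * f ≤ e ∧ e * f ≤ f := ⟨le_of_idem_right hf, le_of_idem_left he⟩

theorem gba_bot_le {E : Type u} (B : GeneralizedBooleanAlgebra E) (x : E) : B.le B.bot x := bot_le

theorem gba_sdiff_inf {E : Type u} (B : GeneralizedBooleanAlgebra E) (x y : E) :
    B.inf (B.sdiff x y) y = B.bot := inf_sdiff_self_left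

theorem gba_le_sdiff {E : Type u} (B : GeneralizedBooleanAlgebra E) {x y z : E}
    (h : B.le x y) (h' : B.inf x z = B.bot) : B.le x (B.sdiff y z) :=
  le_sdiff.2 ⟨h, disjoint_iff.2 h'⟩

theorem exists_idem_sdiff (hS : IsBooleanInverseMeetSemigroup S) {f g : S}
    (hf : IsIdempotentElem f) (hg : IsIdempotentElem g) : ∃ e, IsIdempotentElem e ∧ e * g = 0 ∧
      ∀ h, IsIdempotentElem h → h ≤ f → h * g = 0 → h ≤ e := by
  obtain ⟨B, hB⟩ := hS.boolean
  have h0 : IsIdempotentElem (0 : S) := InverseSemigroupWithZero.zero_mul' 0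
  have hbot : (B.bot : Idem S).1 = 0 := le_zero_iff.1 ((hB B.bot ⟨0, h0⟩).1 (gba_bot_le B _))
  let f' : Idem S := ⟨f, hf⟩
  let g' : Idem S := ⟨g, hg⟩
  have key : ∀ h : Idem S, h.1 * g = 0 ↔ B.inf h g' = B.bot := by
    intro h
    constructor
    · intro hh
      apply B.le_antisymm _ _ _ (gba_bot_le B _)
      rw [hB]
      have h1 : (B.inf h g').1 ≤ h.1 := (hB _ _).1 (B.inf_le_left h g')
      have h2 : (B.inf h g').1 ≤ g := (hB _ _).1 (B.inf_le_right h g')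
      have h3 := mul_le h1 h2
      rw [(B.inf h g').2.eq, hh] at h3
      change (B.inf h g').1 ≤ (B.bot : Idem S).1
      rwa [hbot]
    · intro hh
      have h1 := idem_inf h.2 hg
      let m : Idem S := ⟨h.1 * g, idem_mul h.2 hg⟩
      have h2 : B.le m (B.inf h g') := B.le_inf _ _ _ ((hB m h).2 h1.1) ((hB m g').2 h1.2)
      rw [hh, hB] at h2
      have h3 : h.1 * g ≤ (B.bot : Idem S).1 := h2
      rw [hbot] at h3
      exact le_zero_iff.1 h3
  refine ⟨(B.sdiff f' g').1, (B.sdiff f' g').2, ?_, ?_⟩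
  · rw [key]
    exact gba_sdiff_inf B f' g'
  · intro h hh hle h2
    have h3 : B.inf ⟨h, hh⟩ g' = B.bot := (key ⟨h, hh⟩).1 h2
    refine (hB ⟨h, hh⟩ _).1 ?_
    have h4 : B.le ⟨h, hh⟩ f' := (hB ⟨h, hh⟩ f').2 hle
    exact gba_le_sdiff B h4 h3

theorem isCompact_V (hS : IsBooleanInverseMeetSemigroup S) (a : S) : IsCompact (V a) := by
  rw [isCompact_iff_ultrafilter_le_nhds']
  intro 𝒰 h𝒰
  have hF : IsFilter {s : S | V s ∈ 𝒰} := by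
    refine ⟨⟨a, h𝒰⟩, ?_, ?_, ?_⟩
    · intro x y hx hy
      obtain ⟨m, hm⟩ := hS.exists_meet x y
      have h1 : m ≤ x := hm.1 (by simp)
      have h2 : m ≤ y := hm.1 (by simp)
      refine ⟨m, ?_, h1, h2⟩
      refine Filter.mem_of_superset (Filter.inter_mem hx hy) ?_
      rintro A ⟨hA, hA'⟩
      obtain ⟨z, hz, hzx, hzy⟩ := A.2.1.directed x y hA hA'
      refine A.2.1.closed z m hz (hm.2 ?_)
      rintro w (rfl | rfl)
      exacts [hzx, hzy]
    · intro x y hx h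
      exact Filter.mem_of_superset hx fun A hA => A.2.1.closed _ _ hA h
    · intro h
      have : V (0 : S) = ∅ := by
        ext A
        simp only [Set.mem_empty_iff_false, iff_false]
        exact A.2.1.zero_notMem
      change V (0 : S) ∈ 𝒰 at h
      rw [this] at h
      exact 𝒰.empty_notMem h
  have hU : IsUltra {s : S | V s ∈ 𝒰} := by
    refine ⟨hF, fun F' hF' hsub x hx => ?_⟩
    by_contra hxF
    change V x ∉ 𝒰 at hxF
    obtain ⟨m, hm⟩ := hS.exists_meet a x
    have hma : m ≤ a := hm.1 (by simp)
    have hmx : m ≤ x := hm.1 (by simp)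
    obtain ⟨e, he, hem, hemax⟩ :=
      exists_idem_sdiff hS (idem_inv_mul a) (idem_inv_mul m)
    have hay : m * e = 0 := by
      calc m * e = m * (m⁻¹ * m * e) := by
            rw [← mul_assoc, ← mul_assoc, InverseSemigroup.mul_inv_mul]
        _ = 0 := by
            rw [idem_comm (idem_inv_mul m) he, hem, InverseSemigroupWithZero.mul_zero']
    have hV : V (a * e) ∈ 𝒰 := by
      have h1 : V a ∩ (V x)ᶜ ∈ 𝒰 :=
        Filter.inter_mem h𝒰 (Ultrafilter.compl_mem_iff_notMem.2 hxF)
      refine Filter.mem_of_superset h1 ?_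
      rintro A ⟨hA, hA'⟩
      obtain ⟨b, hb, hbx⟩ := ultra_exists_of_notMem hS hA'
      obtain ⟨c, hc, hcb, hca⟩ := A.2.1.directed b a hb hA
      refine A.2.1.closed c _ hc ?_
      have h2 := le_iff_mul_dom.1 hca
      have h3 : c⁻¹ * c ≤ a⁻¹ * a := mul_le (inv_le hca) hca
      have h4 : c⁻¹ * c * (m⁻¹ * m) = 0 := by
        have h5 : c * (m⁻¹ * m) = 0 := by
          refine hbx _ (le_trans (le_of_idem_right (idem_inv_mul m)) hcb) ?_
          have h6 : c * (m⁻¹ * m) ≤ a * (m⁻¹ * m) := mul_le hca le_rfl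
          rw [← le_iff_mul_dom.1 hma] at h6
          exact h6.trans hmx
        rw [mul_assoc, h5, InverseSemigroupWithZero.mul_zero']
      have h7 := hemax _ (idem_inv_mul c) h3 h4
      rw [h2]
      exact mul_le le_rfl h7
    obtain ⟨z, hz, hzx, hzy⟩ := hF'.directed x (a * e) hx (hsub hV)
    have hzm : z ≤ m := by
      refine hm.2 ?_
      rintro w (rfl | rfl)
      exacts [hzy.trans (le_of_idem_right he), hzx]
    have hz1 : z * e = z := by
      obtain ⟨f, hf, rfl⟩ := hzy
      rw [mul_assoc, mul_assoc, idem_comm hf he, ← mul_assoc e e, he.eq, ← mul_assoc]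
    have hz2 : z * e ≤ m * e := mul_le hzm le_rfl
    rw [hz1, hay, le_zero_iff] at hz2
    exact hF'.zero_notMem (hz2 ▸ hz)
  refine ⟨⟨_, hU⟩, h𝒰, ?_⟩
  intro N hN
  obtain ⟨_, ⟨s, rfl⟩, hs, hsN⟩ := (isTopologicalBasis_V).mem_nhds_iff.1 hN
  exact Filter.mem_of_superset (show V s ∈ 𝒰 from hs) hsN

theorem basis_ultra (hS : IsBooleanInverseMeetSemigroup S) :
    TopologicalSpace.IsTopologicalBasis
      {U : Set (UltrafilterGroupoid S) | IsOpen U ∧ IsCompact U ∧ IsLocalBisection U} := by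
  refine TopologicalSpace.isTopologicalBasis_of_isOpen_of_nhds (fun U hU => hU.1) ?_
  intro A U hA hU
  obtain ⟨_, ⟨s, rfl⟩, hs, hsN⟩ := (isTopologicalBasis_V).exists_subset_of_mem_open hA hU
  exact ⟨V s, ⟨isOpen_V s, isCompact_V hS s, isLocalBisection_V s⟩, hs, hsN⟩

theorem ultra_dom_eq_of_idem {A : UltrafilterGroupoid S} {e : S} (he : IsIdempotentElem e)
    (h : e ∈ A.1) : dom A = A := by
  apply ultra_eq_of_dom (a := e) _ h (dom_dom A)
  have := ultra_dom_mem h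
  rwa [idem_inv he, he.eq] at this

theorem V_subset_identities {e : S} (he : IsIdempotentElem e) :
    V e ⊆ identities (UltrafilterGroupoid S) := fun _ h => ultra_dom_eq_of_idem he h

theorem isOpen_identities_ultra : IsOpen (identities (UltrafilterGroupoid S)) := by
  rw [isOpen_iff_forall_mem_open]
  intro A hA
  obtain ⟨a, ha⟩ := A.2.1.nonempty
  refine ⟨V (a⁻¹ * a), V_subset_identities (idem_inv_mul a), isOpen_V _, ?_⟩
  have := ultra_dom_mem ha
  rwa [show dom A = A from hA] at this

theorem isBooleanSpace_identities {G : Type u} [ArrowGroupoid G] [TopologicalSpace G] [T2Space G]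
    (h : TopologicalSpace.IsTopologicalBasis
      {U : Set G | IsOpen U ∧ IsCompact U ∧ IsLocalBisection U})
    (ho : IsOpen (identities G)) : IsBooleanSpace (identities G) := by
  refine ⟨inferInstance, ?_⟩
  refine TopologicalSpace.isTopologicalBasis_of_isOpen_of_nhds (fun U hU => hU.1) ?_
  intro e U he hU
  have h1 : IsOpen (Subtype.val '' U : Set G) := ho.isOpenMap_subtype_val U hU
  obtain ⟨W, hW, heW, hWU⟩ := h.exists_subset_of_mem_open (Set.mem_image_of_mem _ he) h1
  refine ⟨Subtype.val ⁻¹' W, ⟨hW.1.preimage continuous_subtype_val, ?_⟩, heW, ?_⟩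
  · rw [Topology.IsInducing.subtypeVal.isCompact_preimage_iff]
    · exact hW.2.1
    · intro x hx
      obtain ⟨y, -, rfl⟩ := hWU hx
      exact ⟨y, rfl⟩
  · intro x hx
    obtain ⟨y, hy, h2⟩ := hWU hx
    rwa [← Subtype.ext h2]

theorem continuous_inv_ultra : Continuous (inv : UltrafilterGroupoid S → UltrafilterGroupoid S) := by
  refine continuous_generateFrom_iff.2 ?_
  rintro _ ⟨a, rfl⟩
  have : (inv : UltrafilterGroupoid S → UltrafilterGroupoid S) ⁻¹' V a = V a⁻¹ := by
    ext A
    exact mem_filterInv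
  rw [this]
  exact isOpen_V _

theorem continuous_comp_ultra : Continuous
    fun p : {p : UltrafilterGroupoid S × UltrafilterGroupoid S // dom p.1 = cod p.2} =>
      comp p.1.1 p.1.2 p.2 := by
  refine continuous_generateFrom_iff.2 ?_
  rintro _ ⟨a, rfl⟩
  rw [isOpen_iff_forall_mem_open]
  rintro ⟨⟨A, B⟩, w⟩ ⟨x, hx, y, hy, h⟩
  refine ⟨Subtype.val ⁻¹' (V x ×ˢ V y), ?_, ((isOpen_V x).prod (isOpen_V y)).preimage
    continuous_subtype_val, ⟨hx, hy⟩⟩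
  rintro ⟨⟨A', B'⟩, w'⟩ ⟨hx', hy'⟩
  exact ⟨x, hx', y, hy', h⟩

/-- Every ultrafilter containing `a⁻¹ * a` is the domain of an ultrafilter containing `a`. -/
theorem exists_ultra_dom {E : UltrafilterGroupoid S} {a : S} (h : a⁻¹ * a ∈ E.1) :
    ∃ A : UltrafilterGroupoid S, a ∈ A.1 ∧ dom A = E := by
  have hE : dom E = E := ultra_dom_eq_of_idem (idem_inv_mul a) h
  have hinv : inv E = E := by
    have h1 : inv E = dom E := by
      apply ultra_eq_of_cod (a := a⁻¹ * a)
      · refine ⟨_, h, ?_⟩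
        change (a⁻¹ * a)⁻¹ = _
        rw [idem_inv (idem_inv_mul a)]
      · rwa [hE]
      · rw [cod_inv, cod_dom]
    rw [h1, hE]
  have hmulE : ∀ x ∈ E.1, ∀ y ∈ E.1, x * y ∈ E.1 := by
    intro x hx y hy
    rw [← hE]
    rw [← hinv] at hx
    exact ⟨x, hx, y, hy, le_rfl⟩
  have hinvE : ∀ x ∈ E.1, x⁻¹ ∈ E.1 := by
    intro x hx
    rw [← hinv]
    exact ⟨x, hx, rfl⟩
  have hF : IsFilter {x | ∃ f ∈ E.1, a * f ≤ x} := by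
    refine ⟨?_, ?_, ?_, ?_⟩
    · exact ⟨_, _, h, le_rfl⟩
    · rintro x y ⟨f, hf, h⟩ ⟨g, hg, h'⟩
      obtain ⟨z, hz, hzf, hzg⟩ := E.2.1.directed f g hf hg
      exact ⟨_, ⟨z, hz, le_rfl⟩, (mul_le le_rfl hzf).trans h, (mul_le le_rfl hzg).trans h'⟩
    · rintro x y ⟨f, hf, h⟩ h'
      exact ⟨f, hf, h.trans h'⟩
    · rintro ⟨f, hf, h'⟩
      rw [le_zero_iff] at h'
      have h2 := hmulE _ h _ hf
      rw [mul_assoc, h', InverseSemigroupWithZero.mul_zero'] at h2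
      exact E.2.1.zero_notMem h2
  have hU : IsUltra {x | ∃ f ∈ E.1, a * f ≤ x} := by
    refine ⟨hF, fun F hF' hsub => ?_⟩
    have haF : a ∈ F := hsub ⟨_, h, by rw [← mul_assoc, InverseSemigroup.mul_inv_mul]⟩
    have hD := isFilter_dom hF'
    have hED : E.1 ⊆ filterMul (filterInv F) F := by
      intro f hf
      refine ⟨a⁻¹, ⟨a, haF, rfl⟩, a * f, hsub ⟨f, hf, le_rfl⟩, ?_⟩
      rw [← mul_assoc]
      exact le_of_idem_left (idem_inv_mul a)
    have hDE := E.2.2 hD hED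
    intro x hx
    refine ⟨a⁻¹ * x, hDE ⟨_, ⟨a, haF, rfl⟩, x, hx, le_rfl⟩, ?_⟩
    rw [← mul_assoc]
    exact le_of_idem_left (idem_mul_inv a)
  have haU : a ∈ {x | ∃ f ∈ E.1, a * f ≤ x} :=
    ⟨_, h, by rw [← mul_assoc, InverseSemigroup.mul_inv_mul]⟩
  refine ⟨⟨_, hU⟩, haU, ?_⟩
  refine (ultra_eq_of_subset ?_).symm
  intro f hf
  refine ⟨a⁻¹, ⟨a, haU, rfl⟩, a * f, ⟨f, hf, le_rfl⟩, ?_⟩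
  rw [← mul_assoc]
  exact le_of_idem_left (idem_inv_mul a)

theorem etale_ultra :
    IsLocalHomeomorph (domId : UltrafilterGroupoid S → identities (UltrafilterGroupoid S)) := by
  rw [isLocalHomeomorph_iff_isOpenEmbedding_restrict]
  intro A
  obtain ⟨a, ha⟩ := A.2.1.nonempty
  have hcont : Continuous (domId : UltrafilterGroupoid S → _) := by
    refine Continuous.subtype_mk ?_ _
    have h1 : Continuous fun B : UltrafilterGroupoid S =>
        (⟨(inv B, B), dom_inv B⟩ :
          {p : UltrafilterGroupoid S × UltrafilterGroupoid S // dom p.1 = cod p.2}) :=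
      (continuous_inv_ultra.prodMk continuous_id).subtype_mk _
    exact continuous_comp_ultra.comp h1
  have hopen : IsOpenMap (domId : UltrafilterGroupoid S → _) := by
    refine (isTopologicalBasis_V).isOpenMap_iff.2 ?_
    rintro _ ⟨s, rfl⟩
    refine isOpen_induced_iff.2 ⟨V (s⁻¹ * s), isOpen_V _, ?_⟩
    ext ⟨E, hE⟩
    constructor
    · intro h
      obtain ⟨B, hB, rfl⟩ := exists_ultra_dom (show s⁻¹ * s ∈ E.1 from h)
      exact ⟨B, hB, rfl⟩
    · rintro ⟨B, hB, h⟩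
      have h2 := ultra_dom_mem (A := B) (a := s) hB
      rw [show dom B = E from congrArg Subtype.val h] at h2
      exact h2
  refine ⟨V a, (isOpen_V a).mem_nhds ha, ?_⟩
  refine Topology.IsOpenEmbedding.of_continuous_injective_isOpenMap
    (hcont.comp continuous_subtype_val) ?_ (hopen.comp (isOpen_V a).isOpenMap_subtype_val)
  rintro ⟨B, hB⟩ ⟨C, hC⟩ h
  exact Subtype.ext (ultra_eq_of_dom hB hC (congrArg Subtype.val h))

theorem isHausdorffBooleanGroupoid_ultra (hS : IsBooleanInverseMeetSemigroup S) :
    IsHausdorffBooleanGroupoid (UltrafilterGroupoid S) :=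
  haveI := t2_ultra hS
  { continuous_inv := continuous_inv_ultra
    continuous_comp := continuous_comp_ultra
    etale := etale_ultra
    basis := basis_ultra hS
    identities_boolean := isBooleanSpace_identities (basis_ultra hS) isOpen_identities_ultra
    t2 := inferInstance }

end spectrum

/-! ### The semigroup of compact-open local bisections -/

section bisections

variable {G : Type u} [ArrowGroupoid G]

theorem cod_of_identity {e : G} (he : e ∈ identities G) : cod e = e := by
  have h : dom e = e := he
  rw [← h, cod_dom]

theorem comp_congr {g g' h h' : G} (hg : g = g') (hh : h = h') (w : dom g = cod h)
    (w' : dom g' = cod h') : comp g h w = comp g' h' w' := by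
  subst hg; subst hh; rfl

theorem comp_identity {g e : G} (he : e ∈ identities G) (w : dom g = cod e) : comp g e w = g := by
  have h : e = dom g := by rw [w, cod_of_identity he]
  rw [comp_congr rfl h w (cod_dom g).symm, comp_dom]

theorem identity_comp {g e : G} (he : e ∈ identities G) (w : dom e = cod g) : comp e g w = g := by
  have h : e = cod g := by rw [← w]; exact he.symm
  rw [comp_congr h rfl w (dom_cod g), cod_comp_self]

theorem comp_inv_cancel {g h : G} (w : dom g = cod h)
    (w' : dom (comp g h w) = cod (inv h)) : comp (comp g h w) (inv h) w' = g := by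
  rw [comp_assoc g h (inv h) w (cod_inv h).symm]
  rw [comp_congr rfl (comp_inv h) _ (by rw [cod_cod, w])]
  exact comp_identity (dom_cod h) _

theorem inv_comp_cancel {g h : G} (w : dom g = cod h)
    (w' : dom (inv g) = cod (comp g h w)) : comp (inv g) (comp g h w) w' = h := by
  rw [← comp_assoc (inv g) g h (dom_inv g) w]
  rw [comp_congr (inv_comp g) rfl _ (by rw [dom_dom, w])]
  exact identity_comp (dom_dom g) _

theorem comp_comp_inv {g h : G} (w : dom g = cod (inv h))
    (w' : dom (comp g (inv h) w) = cod h) : comp (comp g (inv h) w) h w' = g := by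
  rw [comp_assoc g (inv h) h w (dom_inv h)]
  rw [comp_congr rfl (inv_comp h) _ (by rw [cod_dom, w, cod_inv])]
  exact comp_identity (dom_dom h) _

theorem eq_of_comp_inv {g h : G} (w : dom g = cod (inv h))
    (hi : comp g (inv h) w ∈ identities G) : g = h := by
  have w' : dom (comp g (inv h) w) = cod h := by rw [dom_comp, dom_inv]
  rw [← comp_comp_inv w w', identity_comp hi w']

theorem eq_of_inv_comp {g h : G} (w : dom (inv g) = cod h)
    (hi : comp (inv g) h w ∈ identities G) : g = h := by
  have h1 : inv g = inv h := by
    have w' : dom (comp (inv g) h w) = cod (inv h) := by rw [dom_comp, cod_inv]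
    rw [← comp_inv_cancel w w', identity_comp hi w']
  rw [← inv_inv_eq g, h1, inv_inv_eq]

theorem bisection_eq_of_dom {A : Set G} (hA : IsLocalBisection A) {g h : G} (hg : g ∈ A)
    (hh : h ∈ A) (w : dom g = dom h) : g = h :=
  eq_of_comp_inv (w.trans (cod_inv h).symm) (hA.2 ⟨g, hg, _, ⟨h, hh, rfl⟩, _, rfl⟩)

theorem bisection_eq_of_cod {A : Set G} (hA : IsLocalBisection A) {g h : G} (hg : g ∈ A)
    (hh : h ∈ A) (w : cod g = cod h) : g = h :=
  eq_of_inv_comp ((dom_inv g).trans w) (hA.1 ⟨_, ⟨g, hg, rfl⟩, h, hh, _, rfl⟩)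

theorem setMul_assoc (A B C : Set G) : setMul (setMul A B) C = setMul A (setMul B C) := by
  ext x
  constructor
  · rintro ⟨_, ⟨g, hg, h, hh, w, rfl⟩, k, hk, w', rfl⟩
    rw [dom_comp] at w'
    exact ⟨g, hg, _, ⟨h, hh, k, hk, w', rfl⟩, _, comp_assoc g h k w w'⟩
  · rintro ⟨g, hg, _, ⟨h, hh, k, hk, w, rfl⟩, w', rfl⟩
    rw [cod_comp] at w'
    exact ⟨_, ⟨g, hg, h, hh, w', rfl⟩, k, hk, _, (comp_assoc g h k w' w).symm⟩

theorem isLocalBisection_mul {A B : Set G} (hA : IsLocalBisection A) (hB : IsLocalBisection B) :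
    IsLocalBisection (setMul A B) := by
  apply isLocalBisection_of
  · rintro _ ⟨a, ha, b, hb, w, rfl⟩ _ ⟨a', ha', b', hb', w', rfl⟩ h
    rw [dom_comp, dom_comp] at h
    obtain rfl := bisection_eq_of_dom hB hb hb' h
    obtain rfl := bisection_eq_of_dom hA ha ha' (w.trans w'.symm)
    rfl
  · rintro _ ⟨a, ha, b, hb, w, rfl⟩ _ ⟨a', ha', b', hb', w', rfl⟩ h
    rw [cod_comp, cod_comp] at h
    obtain rfl := bisection_eq_of_cod hA ha ha' h
    obtain rfl := bisection_eq_of_cod hB hb hb' (w.symm.trans w')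
    rfl

theorem mem_setInv {A : Set G} {g : G} : g ∈ setInv A ↔ inv g ∈ A := by
  constructor
  · rintro ⟨h, hh, rfl⟩
    rwa [inv_inv_eq]
  · intro h
    exact ⟨_, h, inv_inv_eq g⟩

theorem setInv_inv (A : Set G) : setInv (setInv A) = A := by
  ext g
  rw [mem_setInv, mem_setInv, inv_inv_eq]

theorem isLocalBisection_inv {A : Set G} (hA : IsLocalBisection A) :
    IsLocalBisection (setInv A) := by
  constructor
  · rw [setInv_inv]; exact hA.2
  · rw [setInv_inv]; exact hA.1

theorem isLocalBisection_mono {A B : Set G} (hA : IsLocalBisection A) (h : B ⊆ A) :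
    IsLocalBisection B :=
  isLocalBisection_of (fun _ hg _ hh w => bisection_eq_of_dom hA (h hg) (h hh) w)
    (fun _ hg _ hh w => bisection_eq_of_cod hA (h hg) (h hh) w)

theorem isLocalBisection_of_subset {A : Set G} (h : A ⊆ identities G) : IsLocalBisection A := by
  apply isLocalBisection_of
  · intro g hg k hk w
    rwa [show dom g = g from h hg, show dom k = k from h hk] at w
  · intro g hg k hk w
    rwa [cod_of_identity (h hg), cod_of_identity (h hk)] at w

theorem setMul_identities {A E : Set G} (hE : E ⊆ identities G) :
    setMul A E = {g | g ∈ A ∧ dom g ∈ E} := by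
  ext x
  constructor
  · rintro ⟨g, hg, e, he, w, rfl⟩
    rw [comp_identity (hE he)]
    refine ⟨hg, ?_⟩
    rw [w, cod_of_identity (hE he)]
    exact he
  · rintro ⟨hx, he⟩
    exact ⟨x, hx, _, he, (cod_dom x).symm, (comp_dom x).symm⟩

theorem setMul_inv_mul {A : Set G} (hA : IsLocalBisection A) :
    setMul (setMul A (setInv A)) A = A := by
  rw [setMul_assoc, setMul_identities hA.1]
  ext x
  refine ⟨fun h => h.1, fun h => ⟨h, ?_⟩⟩
  exact ⟨_, ⟨x, h, rfl⟩, x, h, dom_inv x, (inv_comp x).symm⟩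

theorem setInv_subset_of_mul {A B : Set G} (hA : IsLocalBisection A)
    (h : setMul (setMul A B) A = A) : setInv A ⊆ B := by
  rintro _ ⟨a, ha, rfl⟩
  have h1 := ha
  rw [← h] at h1
  obtain ⟨_, ⟨a₁, ha₁, b, hb, w, rfl⟩, a₂, ha₂, w', h2⟩ := h1
  have e2 : a = a₂ := bisection_eq_of_dom hA ha ha₂ (by rw [h2, dom_comp])
  have e1 : a = a₁ := bisection_eq_of_cod hA ha ha₁ (by rw [h2, cod_comp, cod_comp])
  subst e2
  subst e1
  have h3 : comp a b w = cod a := by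
    have w3 : dom (comp (comp a b w) a w') = cod (inv a) := by rw [dom_comp, cod_inv]
    rw [← comp_inv_cancel w' w3, comp_congr h2.symm rfl w3 (cod_inv a).symm, comp_inv]
  have h4 : b = inv a := by
    have w4 : dom (inv a) = cod (comp a b w) := by rw [dom_inv, cod_comp]
    rw [← inv_comp_cancel w w4, comp_congr rfl h3 w4 (by rw [dom_inv, cod_cod])]
    exact comp_identity (dom_cod a) _
  rwa [← h4]

variable [TopologicalSpace G]

theorem continuous_dom (hG : IsHausdorffBooleanGroupoid G) : Continuous (dom : G → G) :=
  continuous_subtype_val.comp hG.etale.continuous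

theorem continuous_cod (hG : IsHausdorffBooleanGroupoid G) : Continuous (cod : G → G) := by
  have : (cod : G → G) = dom ∘ inv := by
    funext g
    exact (dom_inv g).symm
  rw [this]
  exact (continuous_dom hG).comp hG.continuous_inv

theorem isOpen_identities (hG : IsHausdorffBooleanGroupoid G) : IsOpen (identities G) := by
  rw [isOpen_iff_forall_mem_open]
  intro e he
  obtain ⟨φ, hφ, hd⟩ := hG.etale e
  refine ⟨φ.source ∩ dom ⁻¹' φ.source, ?_, φ.open_source.inter
    (φ.open_source.preimage (continuous_dom hG)), hφ, ?_⟩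
  · rintro x ⟨hx, hx'⟩
    apply φ.injOn hx' hx
    rw [← hd]
    exact Subtype.ext (dom_dom x)
  · change dom e ∈ φ.source
    rwa [show dom e = e from he]

theorem isOpen_setMul (hG : IsHausdorffBooleanGroupoid G) {U V : Set G} (hU : IsOpen U)
    (hV : IsOpen V) : IsOpen (setMul U V) := by
  rw [isOpen_iff_forall_mem_open]
  rintro _ ⟨u, hu, v, hv, w, rfl⟩
  obtain ⟨φ, hφ, hd⟩ := hG.etale v
  let N : Set G := domId ⁻¹' (φ.target ∩ φ.symm ⁻¹' V)
  have hN : IsOpen N := (φ.symm.isOpen_inter_preimage hV).preimage hG.etale.continuous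
  let s : N → G := fun x => φ.symm (domId x.1)
  have hs : Continuous s := by
    refine φ.symm.continuousOn.comp_continuous
      (hG.etale.continuous.comp continuous_subtype_val) ?_
    exact fun x => x.2.1
  have hds : ∀ x : N, dom (s x) = dom x.1 := by
    intro x
    have h1 : φ (φ.symm (domId x.1)) = domId x.1 := φ.right_inv x.2.1
    rw [← hd] at h1
    exact congrArg Subtype.val h1
  let q : N → {p : G × G // dom p.1 = cod p.2} :=
    fun x => ⟨(x.1, inv (s x)), by rw [cod_inv, hds]⟩
  have hq : Continuous q :=
    (continuous_subtype_val.prodMk (hG.continuous_inv.comp hs)).subtype_mk _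
  have hp := hG.continuous_comp.comp hq
  refine ⟨Subtype.val '' ((fun x => comp (q x).1.1 (q x).1.2 (q x).2) ⁻¹' U), ?_,
    hN.isOpenMap_subtype_val _ (hU.preimage hp), ?_⟩
  · rintro _ ⟨x, hx, rfl⟩
    refine ⟨_, hx, s x, x.2.2, ?_, ?_⟩
    · rw [dom_comp]; exact dom_inv _
    · exact (comp_comp_inv (g := x.1) (h := s x) _ _).symm
  · have hsymm : φ.symm (domId (comp u v w)) = v := by
      have h1 : domId (comp u v w) = φ v := by
        rw [← hd]; exact Subtype.ext (dom_comp u v w)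
      rw [h1, φ.left_inv hφ]
    have hmem : comp u v w ∈ N := by
      refine ⟨?_, ?_⟩
      · have h1 : domId (comp u v w) = φ v := by
          rw [← hd]; exact Subtype.ext (dom_comp u v w)
        rw [h1]
        exact φ.map_source hφ
      · change φ.symm (domId (comp u v w)) ∈ V
        rwa [hsymm]
    refine ⟨⟨_, hmem⟩, ?_, rfl⟩
    change comp (comp u v w) (inv (φ.symm (domId (comp u v w)))) _ ∈ U
    rw [comp_congr rfl (congrArg inv hsymm) _ (by rw [dom_comp, cod_inv]), comp_inv_cancel]
    exact hu

theorem isCompact_setMul (hG : IsHausdorffBooleanGroupoid G) {U V : Set G} (hU : IsCompact U)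
    (hV : IsCompact V) : IsCompact (setMul U V) := by
  have := hG.t2
  have hcl : IsClosed {p : G × G | dom p.1 = cod p.2} :=
    isClosed_eq ((continuous_dom hG).comp continuous_fst) ((continuous_cod hG).comp continuous_snd)
  have h1 := (hcl.isClosedEmbedding_subtypeVal.isCompact_preimage (hU.prod hV)).image
    hG.continuous_comp
  convert h1 using 1
  ext x
  constructor
  · rintro ⟨g, hg, h, hh, w, rfl⟩
    exact ⟨⟨(g, h), w⟩, ⟨hg, hh⟩, rfl⟩
  · rintro ⟨⟨⟨g, h⟩, w⟩, ⟨hg, hh⟩, rfl⟩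
    exact ⟨g, hg, h, hh, w, rfl⟩

end bisections

/-- The set of compact-open local bisections of a topological groupoid. -/
@[ext]
structure CompactOpenBisection (G : Type u) [ArrowGroupoid G] [TopologicalSpace G] : Type u where
  carrier : Set G
  isOpen : IsOpen carrier
  isCompact : IsCompact carrier
  isBisection : IsLocalBisection carrier

/-- The compact-open local bisections of a Hausdorff Boolean groupoid under multiplication and
inversion of subsets, with the empty set as zero. -/
instance (G : HausdorffBooleanGroupoidCat.{u}) :
    InverseSemigroupWithZero (CompactOpenBisection G) where
  mul U V := ⟨setMul U.1 V.1, isOpen_setMul G.isBoolean U.2 V.2,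
    isCompact_setMul G.isBoolean U.3 V.3, isLocalBisection_mul U.4 V.4⟩
  inv U := ⟨setInv U.1, by
      have : setInv U.1 = inv ⁻¹' U.1 := Set.ext fun g => mem_setInv
      rw [this]
      exact U.2.preimage G.isBoolean.continuous_inv,
    U.3.image G.isBoolean.continuous_inv, isLocalBisection_inv U.4⟩
  zero := ⟨∅, isOpen_empty, isCompact_empty, isLocalBisection_of_subset (Set.empty_subset _)⟩
  mul_assoc U V W := CompactOpenBisection.ext (setMul_assoc _ _ _)
  mul_inv_mul U := CompactOpenBisection.ext (setMul_inv_mul U.4)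
  inv_mul_inv U := CompactOpenBisection.ext <| by
    have := setMul_inv_mul (isLocalBisection_inv U.4)
    rwa [setInv_inv] at this
  inv_unique U V h h' := CompactOpenBisection.ext <| by
    have h1 := setInv_subset_of_mul U.4 (congrArg CompactOpenBisection.carrier h)
    have h2 := setInv_subset_of_mul V.4 (congrArg CompactOpenBisection.carrier h')
    refine Set.Subset.antisymm (fun g hg => ?_) h1
    exact mem_setInv.2 (h2 ⟨g, hg, rfl⟩)
  zero_mul' U := CompactOpenBisection.ext <| by
    refine Set.eq_empty_of_forall_notMem ?_
    rintro _ ⟨g, hg, -⟩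
    exact hg
  mul_zero' U := CompactOpenBisection.ext <| by
    refine Set.eq_empty_of_forall_notMem ?_
    rintro _ ⟨_, -, g, hg, -⟩
    exact hg

section bisectionSemigroup

variable {G : HausdorffBooleanGroupoidCat.{u}}

theorem bisection_idem_iff {U : CompactOpenBisection G} :
    IsIdempotentElem U ↔ U.1 ⊆ identities G := by
  constructor
  · intro h
    have h1 : U = U⁻¹ * U := by rw [idem_inv h, h.eq]
    rw [h1]
    exact U.4.1
  · intro h
    apply CompactOpenBisection.ext
    change setMul U.1 U.1 = U.1
    rw [setMul_identities h]
    ext x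
    refine ⟨fun hx => hx.1, fun hx => ⟨hx, ?_⟩⟩
    rwa [show dom x = x from h hx]

theorem bisection_le_iff {U W : CompactOpenBisection G} : U ≤ W ↔ U.1 ⊆ W.1 := by
  constructor
  · rintro ⟨E, hE, rfl⟩ x hx
    have h1 : x ∈ setMul W.1 E.1 := hx
    rw [setMul_identities (bisection_idem_iff.1 hE)] at h1
    exact h1.1
  · intro h
    refine ⟨U⁻¹ * U, idem_inv_mul U, CompactOpenBisection.ext ?_⟩
    change U.1 = setMul W.1 (setMul (setInv U.1) U.1)
    rw [setMul_identities U.4.1]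
    ext x
    constructor
    · intro hx
      exact ⟨h hx, _, ⟨x, hx, rfl⟩, x, hx, dom_inv x, (inv_comp x).symm⟩
    · rintro ⟨hx, _, ⟨g, hg, rfl⟩, k, hk, w, h2⟩
      have h3 : dom x = dom k := by
        rw [← dom_dom x, h2, dom_comp]
      rwa [bisection_eq_of_dom W.4 hx (h hk) h3]

theorem bisection_isLUB {A : Set (CompactOpenBisection G)} {J : CompactOpenBisection G}
    (h : J.1 = ⋃ U ∈ A, U.1) : IsLUB A J := by
  constructor
  · intro U hU
    rw [bisection_le_iff, h]
    exact Set.subset_biUnion_of_mem (u := fun U : CompactOpenBisection G => U.1) hU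
  · intro W hW
    rw [bisection_le_iff, h]
    exact Set.iUnion₂_subset fun U hU => bisection_le_iff.1 (hW hU)

theorem bisection_isGLB {U W J : CompactOpenBisection G} (h : J.1 = U.1 ∩ W.1) :
    IsGLB {U, W} J := by
  constructor
  · rintro X (rfl | rfl)
    · rw [bisection_le_iff, h]; exact Set.inter_subset_left
    · rw [bisection_le_iff, h]; exact Set.inter_subset_right
  · intro X hX
    rw [bisection_le_iff, h]
    exact Set.subset_inter (bisection_le_iff.1 (hX (by simp))) (bisection_le_iff.1 (hX (by simp)))

/-- The intersection of two compact-open local bisections. -/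
def bisectionInter (U W : CompactOpenBisection G) : CompactOpenBisection G :=
  ⟨U.1 ∩ W.1, U.2.inter W.2, haveI := G.isBoolean.t2; U.3.inter W.3,
    isLocalBisection_mono U.4 Set.inter_subset_left⟩

theorem bisection_exists_join (A : Set (CompactOpenBisection G)) (hf : A.Finite)
    (hc : CompatibleSet A) : ∃ J : CompactOpenBisection G, J.1 = ⋃ U ∈ A, U.1 := by
  refine ⟨⟨⋃ U ∈ A, U.1, isOpen_biUnion fun U _ => U.2, hf.isCompact_biUnion fun U _ => U.3,
    ?_⟩, rfl⟩
  apply isLocalBisection_of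
  · intro g hg h hh w
    rw [Set.mem_iUnion₂] at hg hh
    obtain ⟨U, hU, hg⟩ := hg
    obtain ⟨W, hW, hh⟩ := hh
    exact eq_of_comp_inv (w.trans (cod_inv h).symm)
      (bisection_idem_iff.1 (hc U hU W hW).2 ⟨g, hg, _, ⟨h, hh, rfl⟩, _, rfl⟩)
  · intro g hg h hh w
    rw [Set.mem_iUnion₂] at hg hh
    obtain ⟨U, hU, hg⟩ := hg
    obtain ⟨W, hW, hh⟩ := hh
    exact eq_of_inv_comp ((dom_inv g).trans w)
      (bisection_idem_iff.1 (hc U hU W hW).1 ⟨_, ⟨g, hg, rfl⟩, h, hh, _, rfl⟩)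

theorem bisection_join_carrier {A : Set (CompactOpenBisection G)} (hf : A.Finite)
    (hc : CompatibleSet A) {J : CompactOpenBisection G} (hJ : IsLUB A J) :
    J.1 = ⋃ U ∈ A, U.1 := by
  obtain ⟨K, hK⟩ := bisection_exists_join A hf hc
  rw [hJ.unique (bisection_isLUB hK), hK]

theorem bisection_boolean : IsBooleanAlgebraOrder (Idem (CompactOpenBisection G)) := by
  have := G.isBoolean.t2
  let f : Idem (CompactOpenBisection G) → Set G := fun U => U.1.1
  have hid : ∀ U : Idem (CompactOpenBisection G), f U ⊆ identities G :=
    fun U => bisection_idem_iff.1 U.2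
  have hle : ∀ {x y : Idem (CompactOpenBisection G)}, f x ≤ f y ↔ x ≤ y :=
    fun {x y} => (bisection_le_iff (U := x.1) (W := y.1)).symm
  let mk : ∀ X : Set G, IsOpen X → IsCompact X → X ⊆ identities G →
      Idem (CompactOpenBisection G) := fun X h1 h2 h3 =>
    ⟨⟨X, h1, h2, isLocalBisection_of_subset h3⟩, bisection_idem_iff.2 h3⟩
  let _ : Max (Idem (CompactOpenBisection G)) := ⟨fun U W =>
    mk (f U ∪ f W) (U.1.2.union W.1.2) (U.1.3.union W.1.3) (Set.union_subset (hid U) (hid W))⟩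
  let _ : Min (Idem (CompactOpenBisection G)) := ⟨fun U W =>
    mk (f U ∩ f W) (U.1.2.inter W.1.2) (U.1.3.inter W.1.3) (Set.inter_subset_left.trans (hid U))⟩
  let _ : Bot (Idem (CompactOpenBisection G)) := ⟨mk ∅ isOpen_empty isCompact_empty
    (Set.empty_subset _)⟩
  let _ : SDiff (Idem (CompactOpenBisection G)) := ⟨fun U W =>
    mk (f U \ f W) (U.1.2.sdiff W.1.3.isClosed) (U.1.3.diff W.1.2)
      (Set.sdiff_subset.trans (hid U))⟩
  refine ⟨Function.Injective.generalizedBooleanAlgebra f ?_ hle ?_ (fun _ _ => rfl)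
    (fun _ _ => rfl) rfl (fun _ _ => rfl), fun _ _ => Iff.rfl⟩
  · intro U W h
    exact Subtype.ext (CompactOpenBisection.ext h)
  · intro x y
    rw [lt_iff_le_not_ge, lt_iff_le_not_ge, hle, hle]

theorem isBooleanInverseMeetSemigroup_bisections :
    IsBooleanInverseMeetSemigroup (CompactOpenBisection G) where
  exists_meet U W := ⟨bisectionInter U W, bisection_isGLB rfl⟩
  exists_join A hf _ hc := by
    obtain ⟨J, hJ⟩ := bisection_exists_join A hf hc
    exact ⟨J, bisection_isLUB hJ⟩
  mul_join A hf _ hc C J hJ := by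
    apply bisection_isLUB
    have h := bisection_join_carrier hf hc hJ
    change setMul C.1 J.1 = _
    rw [h]
    ext x
    simp only [Set.mem_iUnion, Set.mem_image, exists_prop]
    constructor
    · rintro ⟨c, hcC, y, hy, w, rfl⟩
      rw [Set.mem_iUnion₂] at hy
      obtain ⟨U, hU, hy⟩ := hy
      exact ⟨C * U, ⟨U, hU, rfl⟩, c, hcC, y, hy, w, rfl⟩
    · rintro ⟨_, ⟨U, hU, rfl⟩, c, hcC, y, hy, w, rfl⟩
      exact ⟨c, hcC, y, Set.mem_iUnion₂.2 ⟨U, hU, hy⟩, w, rfl⟩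
  join_mul A hf _ hc C J hJ := by
    apply bisection_isLUB
    have h := bisection_join_carrier hf hc hJ
    change setMul J.1 C.1 = _
    rw [h]
    ext x
    simp only [Set.mem_iUnion, Set.mem_image, exists_prop]
    constructor
    · rintro ⟨y, hy, c, hcC, w, rfl⟩
      rw [Set.mem_iUnion₂] at hy
      obtain ⟨U, hU, hy⟩ := hy
      exact ⟨U * C, ⟨U, hU, rfl⟩, y, hy, c, hcC, w, rfl⟩
    · rintro ⟨_, ⟨U, hU, rfl⟩, y, hy, c, hcC, w, rfl⟩
      exact ⟨y, Set.mem_iUnion₂.2 ⟨U, hU, hy⟩, c, hcC, w, rfl⟩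
  boolean := bisection_boolean

end bisectionSemigroup

/-! ### The two functors -/

section functors

theorem map_inv' {S T : Type u} [InverseSemigroup S] [InverseSemigroup T] (f : S →ₙ* T) (a : S) :
    f a⁻¹ = (f a)⁻¹ := by
  apply InverseSemigroup.inv_unique
  · rw [← map_mul, ← map_mul, InverseSemigroup.mul_inv_mul]
  · rw [← map_mul, ← map_mul, InverseSemigroup.inv_mul_inv]

theorem map_le {S T : Type u} [InverseSemigroup S] [InverseSemigroup T] (f : S →ₙ* T) {a b : S}
    (h : a ≤ b) : f a ≤ f b := by
  obtain ⟨e, he, rfl⟩ := h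
  exact ⟨f e, he.map f, map_mul f b e⟩

/-- The inverse image map `θ⁻¹ : G(T) → G(S)`, a proper continuous covering functor. -/
def ultrafilterComap {S T : BooleanInverseMeetSemigroupCat.{u}} (θ : ProperMorphism S T) :
    ProperCoveringFunctor (UltrafilterGroupoid T) (UltrafilterGroupoid S) :=
  have hcomp : ∀ A B : UltrafilterGroupoid T,
      filterMul (θ.toFun ⁻¹' A.1) (θ.toFun ⁻¹' B.1) ⊆ θ.toFun ⁻¹' filterMul A.1 B.1 := by
    rintro A B x ⟨a, ha, b, hb, h⟩
    refine ⟨θ.toFun a, ha, θ.toFun b, hb, ?_⟩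
    rw [← θ.map_mul']
    exact map_le θ.toMulHom h
  have hinv : ∀ A : UltrafilterGroupoid T,
      θ.toFun ⁻¹' filterInv A.1 = filterInv (θ.toFun ⁻¹' A.1) := by
    intro A
    ext x
    have h1 : θ.toFun x⁻¹ = (θ.toFun x)⁻¹ := map_inv' θ.toMulHom x
    rw [mem_filterInv, Set.mem_preimage, Set.mem_preimage, mem_filterInv, h1]
  have hdom : ∀ A : UltrafilterGroupoid T,
      (⟨θ.toFun ⁻¹' (dom A).1, θ.proper _ (dom A).2⟩ : UltrafilterGroupoid S) =
        dom ⟨θ.toFun ⁻¹' A.1, θ.proper _ A.2⟩ := by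
    intro A
    symm
    apply ultra_eq_of_subset
    change filterMul (filterInv (θ.toFun ⁻¹' A.1)) (θ.toFun ⁻¹' A.1) ⊆
      θ.toFun ⁻¹' filterMul (filterInv A.1) A.1
    rw [← hinv]
    exact hcomp (inv A) A
  have hcont : ∀ s : S, (fun A : UltrafilterGroupoid T =>
      (⟨θ.toFun ⁻¹' A.1, θ.proper _ A.2⟩ : UltrafilterGroupoid S)) ⁻¹' V s = V (θ.toFun s) :=
    fun s => rfl
  have hc : Continuous fun A : UltrafilterGroupoid T =>
      (⟨θ.toFun ⁻¹' A.1, θ.proper _ A.2⟩ : UltrafilterGroupoid S) := by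
    refine continuous_generateFrom_iff.2 ?_
    rintro _ ⟨s, rfl⟩
    rw [hcont]
    exact isOpen_V _
  { toFun := fun A => ⟨θ.toFun ⁻¹' A.1, θ.proper _ A.2⟩
    map_dom := hdom
    map_cod := fun A => by
      symm
      apply ultra_eq_of_subset
      change filterMul (θ.toFun ⁻¹' A.1) (filterInv (θ.toFun ⁻¹' A.1)) ⊆
        θ.toFun ⁻¹' filterMul A.1 (filterInv A.1)
      rw [← hinv]
      exact hcomp A (inv A)
    map_comp := fun A B w => by
      symm
      apply ultra_eq_of_subset
      exact hcomp A B
    star_injective := fun A B h w => by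
      obtain ⟨s, hs⟩ := (θ.proper _ A.2).1.nonempty
      have hs' : s ∈ θ.toFun ⁻¹' B.1 := by
        have : θ.toFun ⁻¹' A.1 = θ.toFun ⁻¹' B.1 := congrArg UltrafilterGroupoid.carrier h
        rwa [← this]
      exact ultra_eq_of_dom (show θ.toFun s ∈ A.1 from hs) hs' w
    star_surjective := fun E P _ w => by
      obtain ⟨p, hp⟩ := P.2.1.nonempty
      have h1 := ultra_dom_mem hp
      rw [w] at h1
      have h2 : θ.toFun (p⁻¹ * p) ∈ E.1 := h1
      have h3 : θ.toFun (p⁻¹ * p) = (θ.toFun p)⁻¹ * θ.toFun p := by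
        rw [θ.map_mul']
        exact congrArg (fun z => z * θ.toFun p) (map_inv' θ.toMulHom p)
      rw [h3] at h2
      obtain ⟨A, hA, hAE⟩ := exists_ultra_dom h2
      refine ⟨A, hAE, ?_⟩
      refine ultra_eq_of_dom (a := p) hA hp ?_
      rw [← hdom, w, hAE]
    continuous := hc
    proper := fun K hK => by
      have := t2_ultra S.isBoolean
      have h1 : K ⊆ ⋃ s : S, V s := by
        intro A _
        obtain ⟨a, ha⟩ := A.2.1.nonempty
        exact Set.mem_iUnion.2 ⟨a, ha⟩
      obtain ⟨t, ht⟩ := hK.elim_finite_subcover _ (fun s => isOpen_V s) h1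
      have h2 : IsCompact (⋃ s ∈ t, V (θ.toFun s)) :=
        t.finite_toSet.isCompact_biUnion fun s _ => isCompact_V T.isBoolean _
      refine h2.of_isClosed_subset (hK.isClosed.preimage hc) ?_
      intro A hA
      have h3 := ht hA
      rw [Set.mem_iUnion₂] at h3 ⊢
      exact h3 }

/-- The functor `S ↦ G(S)` which sends a proper morphism `θ` to `θ⁻¹`. -/
def ultrafilterGroupoidFunctor :
    BooleanInverseMeetSemigroupCat.{u}ᵒᵖ ⥤ HausdorffBooleanGroupoidCat.{u} where
  obj S := ⟨UltrafilterGroupoid S.unop, isHausdorffBooleanGroupoid_ultra S.unop.isBoolean⟩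
  map θ := ultrafilterComap θ.unop
  map_id _ := rfl
  map_comp _ _ := rfl

/-- The inverse image of a compact-open local bisection under a proper continuous covering
functor. -/
def bisectionPreimage {G H : HausdorffBooleanGroupoidCat.{u}} (α : ProperCoveringFunctor G H)
    (U : CompactOpenBisection H) : CompactOpenBisection G where
  carrier := α.toFun ⁻¹' U.1
  isOpen := U.2.preimage α.continuous
  isCompact := α.proper _ U.3
  isBisection := by
    apply isLocalBisection_of
    · intro g hg h hh w
      refine α.star_injective g h (bisection_eq_of_dom U.4 hg hh ?_) w
      rw [← α.map_dom, ← α.map_dom, w]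
    · intro g hg h hh w
      have h1 : α.toFun g = α.toFun h := bisection_eq_of_cod U.4 hg hh <| by
        rw [← α.map_cod, ← α.map_cod, w]
      have key : ∀ k : G, α.toFun (inv k) = inv (α.toFun k) := by
        intro k
        have h2 := α.map_comp (inv k) k (dom_inv k)
        have w2 : dom (α.toFun (inv k)) = cod (α.toFun k) := by
          rw [← α.map_dom, dom_inv, α.map_cod]
        have w3 : dom (comp (α.toFun (inv k)) (α.toFun k) w2) = cod (inv (α.toFun k)) := by
          rw [dom_comp, cod_inv]
        have h4 : comp (α.toFun (inv k)) (α.toFun k) w2 = dom (α.toFun k) := by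
          rw [← α.map_dom, ← inv_comp k]
          exact h2.symm
        rw [← comp_inv_cancel w2 w3, comp_congr h4 rfl w3 (by rw [dom_dom, cod_inv])]
        exact identity_comp (dom_dom _) _
      have h2 : inv g = inv h := α.star_injective _ _ (by rw [key, key, h1])
        (by rw [dom_inv, dom_inv, w])
      rw [← inv_inv_eq g, h2, inv_inv_eq]

theorem bisectionPreimage_mul {G H : HausdorffBooleanGroupoidCat.{u}}
    (α : ProperCoveringFunctor G H) (U W : CompactOpenBisection H) :
    bisectionPreimage α (U * W) = bisectionPreimage α U * bisectionPreimage α W := by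
  apply CompactOpenBisection.ext
  ext g
  constructor
  · rintro ⟨u, hu, v, hv, w, h⟩
    have h1 : dom v = α.toFun (dom g) := by rw [α.map_dom, h, dom_comp]
    obtain ⟨y, hy, rfl⟩ := α.star_surjective (dom g) v (dom_dom g) h1
    have w1 : dom g = cod (inv y) := by rw [cod_inv, hy]
    have w2 : dom (comp g (inv y) w1) = cod y := by rw [dom_comp, dom_inv]
    have w3 : dom (α.toFun (comp g (inv y) w1)) = cod (α.toFun y) := by
      rw [← α.map_dom, w2, α.map_cod]
    have h2 : comp (α.toFun (comp g (inv y) w1)) (α.toFun y) w3 = comp u (α.toFun y) w := by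
      rw [← h, ← α.map_comp _ _ w2, comp_comp_inv]
    have h3 : α.toFun (comp g (inv y) w1) = u := by
      have w4 : dom (comp u (α.toFun y) w) = cod (inv (α.toFun y)) := by rw [dom_comp, cod_inv]
      rw [← comp_inv_cancel w3 (by rw [dom_comp, cod_inv]), comp_congr h2 rfl _ w4,
        comp_inv_cancel]
    refine ⟨comp g (inv y) w1, ?_, y, hv, w2, (comp_comp_inv w1 w2).symm⟩
    change α.toFun _ ∈ U.1
    rwa [h3]
  · rintro ⟨x, hx, y, hy, w, rfl⟩
    exact ⟨_, hx, _, hy, _, α.map_comp x y w⟩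

theorem isUltra_bisections {G : HausdorffBooleanGroupoidCat.{u}} (g : G) :
    IsUltra {U : CompactOpenBisection G | g ∈ U.1} := by
  have := G.isBoolean.t2
  refine ⟨⟨?_, ?_, ?_, ?_⟩, ?_⟩
  · obtain ⟨U, hU, hg, -⟩ :=
      G.isBoolean.basis.exists_subset_of_mem_open (Set.mem_univ g) isOpen_univ
    exact ⟨⟨U, hU.1, hU.2.1, hU.2.2⟩, hg⟩
  · intro U W hU hW
    exact ⟨bisectionInter U W, ⟨hU, hW⟩, bisection_le_iff.2 Set.inter_subset_left,
      bisection_le_iff.2 Set.inter_subset_right⟩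
  · intro U W hU h
    exact bisection_le_iff.1 h hU
  · exact fun h => h
  · intro F hF hsub U hU
    by_contra hg
    obtain ⟨W, hW, hgW, hWU⟩ := G.isBoolean.basis.exists_subset_of_mem_open
      (show g ∈ U.1ᶜ from hg) U.3.isClosed.isOpen_compl
    obtain ⟨Z, hZ, h1, h2⟩ := hF.directed U ⟨W, hW.1, hW.2.1, hW.2.2⟩ hU (hsub hgW)
    have h3 : Z = 0 := by
      apply CompactOpenBisection.ext
      refine Set.eq_empty_of_forall_notMem fun x hx => ?_
      exact hWU (bisection_le_iff.1 h2 hx) (bisection_le_iff.1 h1 hx)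
    exact hF.zero_notMem (h3 ▸ hZ)

/-- Every ultrafilter of compact-open local bisections consists of those which contain some fixed
arrow. -/
theorem exists_of_isUltra {G : HausdorffBooleanGroupoidCat.{u}}
    {F : Set (CompactOpenBisection G)} (hF : IsUltra F) : ∃ g : G, F = {U | g ∈ U.1} := by
  have := G.isBoolean.t2
  obtain ⟨U₀, hU₀⟩ := hF.1.nonempty
  have hne : (⋂ U : F, U.1.1).Nonempty := by
    have : Nonempty F := ⟨⟨U₀, hU₀⟩⟩
    refine IsCompact.nonempty_iInter_of_directed_nonempty_isCompact_isClosed _ ?_ ?_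
      (fun U => U.1.3) (fun U => U.1.3.isClosed)
    · intro U W
      obtain ⟨Z, hZ, h1, h2⟩ := hF.1.directed U.1 W.1 U.2 W.2
      exact ⟨⟨Z, hZ⟩, bisection_le_iff.1 h1, bisection_le_iff.1 h2⟩
    · intro U
      by_contra h
      rw [Set.not_nonempty_iff_eq_empty] at h
      have h3 : U.1 = 0 := CompactOpenBisection.ext h
      exact hF.1.zero_notMem (h3 ▸ U.2)
  obtain ⟨g, hg⟩ := hne
  have hsub : F ⊆ {U | g ∈ U.1} := fun U hU => Set.mem_iInter.1 hg ⟨U, hU⟩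
  exact ⟨g, hsub.antisymm (hF.2 (isUltra_bisections g).1 hsub)⟩

/-- The inverse image map `α⁻¹ : B(H) → B(G)`, a proper morphism. -/
def bisectionComap {G H : HausdorffBooleanGroupoidCat.{u}} (α : ProperCoveringFunctor G H) :
    ProperMorphism (CompactOpenBisection H) (CompactOpenBisection G) where
  toFun := bisectionPreimage α
  map_mul' := bisectionPreimage_mul α
  map_meet U W J h := by
    apply bisection_isGLB
    have h1 : J = bisectionInter U W := h.unique (bisection_isGLB rfl)
    subst h1
    rfl
  map_zero := rfl
  map_idem_meet E F J h := by
    let K : Idem (CompactOpenBisection H) :=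
      ⟨bisectionInter E.1 F.1, bisection_idem_iff.2
        (Set.inter_subset_left.trans (bisection_idem_iff.1 E.2))⟩
    have h0 : IsGLB {E, F} K := by
      have h2 : IsGLB {E.1, F.1} K.1 := bisection_isGLB rfl
      constructor
      · rintro X (rfl | rfl)
        · exact h2.1 (by simp)
        · exact h2.1 (by simp)
      · intro X hX
        refine h2.2 ?_
        rintro Y (rfl | rfl)
        · exact hX (by simp)
        · exact hX (by simp)
    have h1 : J = K := h.unique h0
    subst h1
    have h2 : IsGLB {bisectionPreimage α E.1, bisectionPreimage α F.1} (bisectionPreimage α K.1) :=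
      bisection_isGLB rfl
    constructor
    · rintro X (rfl | rfl)
      · exact h2.1 (Set.mem_insert _ _)
      · exact h2.1 (Set.mem_insert_of_mem _ rfl)
    · intro X hX
      refine h2.2 ?_
      rintro Y (rfl | rfl)
      · exact hX (Set.mem_insert _ _)
      · exact hX (Set.mem_insert_of_mem _ rfl)
  map_idem_join E F J h := by
    have hsub : E.1.1 ∪ F.1.1 ⊆ identities H :=
      Set.union_subset (bisection_idem_iff.1 E.2) (bisection_idem_iff.1 F.2)
    let K : Idem (CompactOpenBisection H) :=
      ⟨⟨E.1.1 ∪ F.1.1, E.1.2.union F.1.2, E.1.3.union F.1.3, isLocalBisection_of_subset hsub⟩,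
        bisection_idem_iff.2 hsub⟩
    have h0 : IsLUB {E, F} K := by
      constructor
      · rintro X (rfl | rfl)
        · exact bisection_le_iff.2 Set.subset_union_left
        · exact bisection_le_iff.2 Set.subset_union_right
      · intro X hX
        exact bisection_le_iff.2 (Set.union_subset
          (bisection_le_iff.1 (hX (Set.mem_insert _ _)))
          (bisection_le_iff.1 (hX (Set.mem_insert_of_mem _ rfl))))
    have h1 : J = K := h.unique h0
    subst h1
    constructor
    · rintro X (rfl | rfl)
      · exact bisection_le_iff.2 (Set.preimage_mono Set.subset_union_left)
      · exact bisection_le_iff.2 (Set.preimage_mono Set.subset_union_right)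
    · intro X hX
      refine bisection_le_iff.2 ?_
      rintro g (hg | hg)
      · exact bisection_le_iff.1 (hX (Set.mem_insert _ _)) hg
      · exact bisection_le_iff.1 (hX (Set.mem_insert_of_mem _ rfl)) hg
  proper F hF := by
    obtain ⟨g, rfl⟩ := exists_of_isUltra hF
    exact isUltra_bisections (α.toFun g)

/-- The functor `G ↦ B(G)` which sends a proper continuous covering functor `α` to `α⁻¹`. -/
def bisectionFunctor :
    HausdorffBooleanGroupoidCat.{u} ⥤ BooleanInverseMeetSemigroupCat.{u}ᵒᵖ where
  obj G := Opposite.op ⟨CompactOpenBisection G, isBooleanInverseMeetSemigroup_bisections⟩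
  map α := Quiver.Hom.op (X := BooleanInverseMeetSemigroupCat.mk _
    isBooleanInverseMeetSemigroup_bisections) (Y := BooleanInverseMeetSemigroupCat.mk _
    isBooleanInverseMeetSemigroup_bisections) (bisectionComap α)
  map_id _ := rfl
  map_comp _ _ := rfl

end functors

/-! ### The categories of classical Stone duality, and their inclusions -/

/-- Bundled (generalized, i.e. not necessarily unital) Boolean algebras. -/
structure BooleanAlgebraCat : Type (u + 1) where
  carrier : Type u
  [str : GeneralizedBooleanAlgebra carrier]

attribute [instance] BooleanAlgebraCat.str

/-- A proper homomorphism of Boolean algebras: a lattice homomorphism preserving the bottom element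
such that every element of the codomain lies beneath an element of the image. -/
@[ext]
structure ProperBooleanHom (A B : Type u) [GeneralizedBooleanAlgebra A]
    [GeneralizedBooleanAlgebra B] extends LatticeHom A B where
  map_bot : toFun ⊥ = ⊥
  proper (b : B) : ∃ a : A, b ≤ toFun a

/-- The category of Boolean algebras and proper homomorphisms. -/
instance : Category BooleanAlgebraCat.{u} where
  Hom A B := ProperBooleanHom A.carrier B.carrier
  id A :=
    { LatticeHom.id A.carrier with
      map_bot := rfl
      proper := fun b => ⟨b, le_rfl⟩ }
  comp f g :=
    { g.toLatticeHom.comp f.toLatticeHom with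
      map_bot := (congrArg g.toFun f.map_bot).trans g.map_bot
      proper := fun c => by
        obtain ⟨b, hb⟩ := g.proper c
        obtain ⟨a, ha⟩ := f.proper b
        exact ⟨a, hb.trans (OrderHomClass.mono g.toLatticeHom ha)⟩ }

/-- Bundled Boolean spaces. -/
structure BooleanSpaceCat : Type (u + 1) where
  carrier : Type u
  [top : TopologicalSpace carrier]
  isBoolean : IsBooleanSpace carrier

attribute [instance] BooleanSpaceCat.top

/-- A proper continuous function: inverse images of compact sets are compact. -/
@[ext]
structure ProperContinuousMap (X Y : Type u) [TopologicalSpace X] [TopologicalSpace Y] where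
  toFun : X → Y
  continuous : Continuous toFun
  proper (K : Set Y) : IsCompact K → IsCompact (toFun ⁻¹' K)

/-- The category of Boolean spaces and proper continuous functions. -/
instance : Category BooleanSpaceCat.{u} where
  Hom X Y := ProperContinuousMap X.carrier Y.carrier
  id X := ⟨fun x => x, continuous_id, fun _ h => h⟩
  comp f g := ⟨fun x => g.toFun (f.toFun x), g.continuous.comp f.continuous,
    fun K hK => f.proper _ (g.proper K hK)⟩

/-- A Boolean algebra, regarded as an inverse semigroup under meet. -/
@[ext]
structure MeetSemigroup (A : Type u) : Type u where
  val : A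

section meetSemigroup

variable {A B : Type u} [GeneralizedBooleanAlgebra A] [GeneralizedBooleanAlgebra B]

instance : InverseSemigroupWithZero (MeetSemigroup A) where
  mul a b := ⟨a.val ⊓ b.val⟩
  inv a := a
  zero := ⟨⊥⟩
  mul_assoc a b c := MeetSemigroup.ext (inf_assoc a.val b.val c.val)
  mul_inv_mul a := MeetSemigroup.ext (by change a.val ⊓ a.val ⊓ a.val = a.val; simp)
  inv_mul_inv a := MeetSemigroup.ext (by change a.val ⊓ a.val ⊓ a.val = a.val; simp)
  inv_unique a b h h' := MeetSemigroup.ext <| by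
    have h1 : a.val ⊓ b.val ⊓ a.val = a.val := congrArg MeetSemigroup.val h
    have h2 : b.val ⊓ a.val ⊓ b.val = b.val := congrArg MeetSemigroup.val h'
    apply le_antisymm
    · rw [← h2]; exact inf_le_left.trans inf_le_right
    · rw [← h1]
      exact inf_le_left.trans inf_le_right
  zero_mul' a := MeetSemigroup.ext (bot_inf_eq a.val)
  mul_zero' a := MeetSemigroup.ext (inf_bot_eq a.val)

theorem meetSemigroup_idem (a : MeetSemigroup A) : IsIdempotentElem a :=
  MeetSemigroup.ext (inf_idem a.val)

theorem meetSemigroup_le_iff {a b : MeetSemigroup A} : a ≤ b ↔ a.val ≤ b.val := by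
  constructor
  · rintro ⟨e, -, rfl⟩
    exact inf_le_left
  · intro h
    exact ⟨a, meetSemigroup_idem a, MeetSemigroup.ext (inf_eq_right.2 h).symm⟩

theorem meetSemigroup_isGLB (a b : MeetSemigroup A) : IsGLB {a, b} ⟨a.val ⊓ b.val⟩ := by
  constructor
  · rintro x (rfl | rfl)
    exacts [meetSemigroup_le_iff.2 inf_le_left, meetSemigroup_le_iff.2 inf_le_right]
  · intro x hx
    exact meetSemigroup_le_iff.2 (le_inf (meetSemigroup_le_iff.1 (hx (Set.mem_insert _ _)))
      (meetSemigroup_le_iff.1 (hx (Set.mem_insert_of_mem _ rfl))))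

theorem meetSemigroup_isLUB_sup {s : Set (MeetSemigroup A)} (hs : s.Finite) :
    IsLUB s ⟨hs.toFinset.sup MeetSemigroup.val⟩ := by
  constructor
  · intro a ha
    exact meetSemigroup_le_iff.2 (Finset.le_sup (f := MeetSemigroup.val) (hs.mem_toFinset.2 ha))
  · intro b hb
    exact meetSemigroup_le_iff.2 (Finset.sup_le fun a ha =>
      meetSemigroup_le_iff.1 (hb (hs.mem_toFinset.1 ha)))

theorem meetSemigroup_mul_join {s : Set (MeetSemigroup A)} (hs : s.Finite) (c j : MeetSemigroup A)
    (hj : IsLUB s j) : IsLUB ((fun a => c * a) '' s) (c * j) := by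
  obtain rfl := hj.unique (meetSemigroup_isLUB_sup hs)
  constructor
  · rintro _ ⟨a, ha, rfl⟩
    exact mul_le le_rfl (hj.1 ha)
  · intro m hm
    refine meetSemigroup_le_iff.2 ?_
    change c.val ⊓ hs.toFinset.sup MeetSemigroup.val ≤ m.val
    rw [Finset.sup_inf_distrib_left]
    exact Finset.sup_le fun a ha =>
      meetSemigroup_le_iff.1 (hm ⟨a, hs.mem_toFinset.1 ha, rfl⟩)

theorem isBooleanInverseMeetSemigroup_meetSemigroup :
    IsBooleanInverseMeetSemigroup (MeetSemigroup A) where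
  exists_meet a b := ⟨_, meetSemigroup_isGLB a b⟩
  exists_join s hs _ _ := ⟨_, meetSemigroup_isLUB_sup hs⟩
  mul_join s hs _ _ c j hj := meetSemigroup_mul_join hs c j hj
  join_mul s hs _ _ c j hj := by
    have h : ∀ a : MeetSemigroup A, a * c = c * a :=
      fun a => MeetSemigroup.ext (inf_comm a.val c.val)
    simp only [h]
    exact meetSemigroup_mul_join hs c j hj
  boolean := by
    let f : Idem (MeetSemigroup A) → A := fun e => e.1.val
    let mk : A → Idem (MeetSemigroup A) := fun a => ⟨⟨a⟩, meetSemigroup_idem _⟩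
    have hle : ∀ {x y : Idem (MeetSemigroup A)}, f x ≤ f y ↔ x ≤ y :=
      fun {x y} => (meetSemigroup_le_iff (a := x.1) (b := y.1)).symm
    let _ : Max (Idem (MeetSemigroup A)) := ⟨fun x y => mk (f x ⊔ f y)⟩
    let _ : Min (Idem (MeetSemigroup A)) := ⟨fun x y => mk (f x ⊓ f y)⟩
    let _ : Bot (Idem (MeetSemigroup A)) := ⟨mk ⊥⟩
    let _ : SDiff (Idem (MeetSemigroup A)) := ⟨fun x y => mk (f x \ f y)⟩
    refine ⟨Function.Injective.generalizedBooleanAlgebra f ?_ hle ?_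
      (fun _ _ => rfl) (fun _ _ => rfl) rfl (fun _ _ => rfl), fun _ _ => Iff.rfl⟩
    · intro x y h
      exact Subtype.ext (MeetSemigroup.ext h)
    · intro x y
      rw [lt_iff_le_not_ge, lt_iff_le_not_ge, hle, hle]

theorem properBooleanHom_mono (f : ProperBooleanHom A B) {a b : A} (h : a ≤ b) :
    f.toFun a ≤ f.toFun b := OrderHomClass.mono f.toLatticeHom h

/-- The semigroup homomorphism underlying a homomorphism of Boolean algebras. -/
def meetSemigroupHom (f : ProperBooleanHom A B) : MeetSemigroup A →ₙ* MeetSemigroup B where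
  toFun a := ⟨f.toFun a.val⟩
  map_mul' a b := MeetSemigroup.ext (f.map_inf' a.val b.val)

theorem meetSemigroup_proper (f : ProperBooleanHom A B) (F : Set (MeetSemigroup B))
    (hF : IsUltra F) : IsUltra (meetSemigroupHom f ⁻¹' F) := by
  have hinf : ∀ a b : A, f.toFun (a ⊓ b) = f.toFun a ⊓ f.toFun b := f.map_inf'
  have hsup : ∀ a b : A, f.toFun (a ⊔ b) = f.toFun a ⊔ f.toFun b := f.map_sup'
  have hfil : IsFilter (meetSemigroupHom f ⁻¹' F) := by
    refine ⟨?_, ?_, ?_, ?_⟩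
    · obtain ⟨b, hb⟩ := hF.1.nonempty
      obtain ⟨a, ha⟩ := f.proper b.val
      exact ⟨⟨a⟩, hF.1.closed b _ hb (meetSemigroup_le_iff.2 ha)⟩
    · intro a b ha hb
      obtain ⟨z, hz, h1, h2⟩ := hF.1.directed _ _ ha hb
      refine ⟨⟨a.val ⊓ b.val⟩, ?_, meetSemigroup_le_iff.2 inf_le_left,
        meetSemigroup_le_iff.2 inf_le_right⟩
      refine hF.1.closed z _ hz (meetSemigroup_le_iff.2 ?_)
      change z.val ≤ f.toFun (a.val ⊓ b.val)
      rw [hinf]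
      exact le_inf (meetSemigroup_le_iff.1 h1) (meetSemigroup_le_iff.1 h2)
    · intro a b ha h
      exact hF.1.closed _ _ ha (map_le (meetSemigroupHom f) h)
    · intro h
      have h0 : (⟨f.toFun ⊥⟩ : MeetSemigroup B) ∈ F := h
      rw [f.map_bot] at h0
      exact hF.1.zero_notMem h0
  refine ⟨hfil, fun Q hQ hsub q hq => ?_⟩
  by_contra hqF
  obtain ⟨b, hb, hbq⟩ := ultra_exists_of_notMem
    (isBooleanInverseMeetSemigroup_meetSemigroup (A := B)) (A := ⟨F, hF⟩)
    (x := meetSemigroupHom f q) hqF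
  obtain ⟨s, hs⟩ := hfil.nonempty
  obtain ⟨z, hz, hzb, hzs⟩ := hF.1.directed b (meetSemigroupHom f s) hb hs
  have h1 : z.val ≤ f.toFun (s.val \ q.val) := by
    have h2 : f.toFun s.val = f.toFun (s.val ⊓ q.val) ⊔ f.toFun (s.val \ q.val) := by
      rw [← hsup, sup_inf_sdiff]
    have h3 : z.val ⊓ f.toFun q.val = ⊥ := by
      have := hbq ⟨z.val ⊓ f.toFun q.val⟩
        (meetSemigroup_le_iff.2 (inf_le_left.trans (meetSemigroup_le_iff.1 hzb)))
        (meetSemigroup_le_iff.2 inf_le_right)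
      exact congrArg MeetSemigroup.val this
    have h4 : z.val ≤ f.toFun s.val := meetSemigroup_le_iff.1 hzs
    have h5 : z.val ⊓ f.toFun (s.val ⊓ q.val) = ⊥ := by
      rw [← le_bot_iff, ← h3]
      exact inf_le_inf_left _ (properBooleanHom_mono f inf_le_right)
    calc z.val = z.val ⊓ f.toFun s.val := (inf_eq_left.2 h4).symm
      _ = z.val ⊓ f.toFun (s.val \ q.val) := by rw [h2, inf_sup_left, h5, bot_sup_eq]
      _ ≤ f.toFun (s.val \ q.val) := inf_le_right
  have h6 : (⟨s.val \ q.val⟩ : MeetSemigroup A) ∈ Q :=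
    hsub (hF.1.closed z _ hz (meetSemigroup_le_iff.2 h1))
  obtain ⟨w, hw, hw1, hw2⟩ := hQ.directed _ _ h6 hq
  have h7 : w = 0 := by
    have h8 := le_inf (meetSemigroup_le_iff.1 hw1) (meetSemigroup_le_iff.1 hw2)
    exact MeetSemigroup.ext (le_bot_iff.1 (h8.trans inf_sdiff_self_left.le))
  exact hQ.zero_notMem (h7 ▸ hw)

/-- A proper homomorphism of Boolean algebras, regarded as a proper morphism. -/
def meetSemigroupMap (f : ProperBooleanHom A B) :
    ProperMorphism (MeetSemigroup A) (MeetSemigroup B) where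
  __ := meetSemigroupHom f
  map_meet a b c h := by
    obtain rfl := h.unique (meetSemigroup_isGLB a b)
    have h1 := meetSemigroup_isGLB (meetSemigroupHom f a) (meetSemigroupHom f b)
    have h2 : f.toFun (a.val ⊓ b.val) = f.toFun a.val ⊓ f.toFun b.val := f.map_inf' _ _
    change IsGLB {meetSemigroupHom f a, meetSemigroupHom f b} ⟨f.toFun (a.val ⊓ b.val)⟩
    rw [h2]
    exact h1
  map_zero := MeetSemigroup.ext f.map_bot
  map_idem_meet e g k h := by
    have h0 : k.1.val = e.1.val ⊓ g.1.val := by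
      apply le_antisymm
      · exact le_inf (meetSemigroup_le_iff.1 (h.1 (Set.mem_insert _ _)))
          (meetSemigroup_le_iff.1 (h.1 (Set.mem_insert_of_mem _ rfl)))
      · let m : Idem (MeetSemigroup A) := ⟨⟨e.1.val ⊓ g.1.val⟩, meetSemigroup_idem _⟩
        have h1 : m ≤ k := by
          refine h.2 ?_
          rintro y (rfl | rfl)
          exacts [meetSemigroup_le_iff.2 inf_le_left, meetSemigroup_le_iff.2 inf_le_right]
        exact meetSemigroup_le_iff.1 h1
    have h2 : f.toFun k.1.val = f.toFun e.1.val ⊓ f.toFun g.1.val := by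
      rw [h0]; exact f.map_inf' _ _
    constructor
    · rintro x (rfl | rfl)
      · exact meetSemigroup_le_iff.2 (h2.le.trans inf_le_left)
      · exact meetSemigroup_le_iff.2 (h2.le.trans inf_le_right)
    · intro x hx
      exact meetSemigroup_le_iff.2 (le_trans
        (le_inf (meetSemigroup_le_iff.1 (hx (Set.mem_insert _ _)))
          (meetSemigroup_le_iff.1 (hx (Set.mem_insert_of_mem _ rfl)))) h2.ge)
  map_idem_join e g k h := by
    have h0 : k.1.val = e.1.val ⊔ g.1.val := by
      apply le_antisymm
      · let m : Idem (MeetSemigroup A) := ⟨⟨e.1.val ⊔ g.1.val⟩, meetSemigroup_idem _⟩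
        have h1 : k ≤ m := by
          refine h.2 ?_
          rintro y (rfl | rfl)
          exacts [meetSemigroup_le_iff.2 le_sup_left, meetSemigroup_le_iff.2 le_sup_right]
        exact meetSemigroup_le_iff.1 h1
      · exact sup_le (meetSemigroup_le_iff.1 (h.1 (Set.mem_insert _ _)))
          (meetSemigroup_le_iff.1 (h.1 (Set.mem_insert_of_mem _ rfl)))
    have h2 : f.toFun k.1.val = f.toFun e.1.val ⊔ f.toFun g.1.val := by
      rw [h0]; exact f.map_sup' _ _
    constructor
    · rintro x (rfl | rfl)
      · exact meetSemigroup_le_iff.2 (le_sup_left.trans h2.ge)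
      · exact meetSemigroup_le_iff.2 (le_sup_right.trans h2.ge)
    · intro x hx
      exact meetSemigroup_le_iff.2 (h2.le.trans
        (sup_le (meetSemigroup_le_iff.1 (hx (Set.mem_insert _ _)))
          (meetSemigroup_le_iff.1 (hx (Set.mem_insert_of_mem _ rfl)))))
  proper := meetSemigroup_proper f

end meetSemigroup

/-- Boolean algebras and proper homomorphisms, as Boolean inverse meet-semigroups and proper
morphisms. -/
def algebraInclusion : BooleanAlgebraCat.{u} ⥤ BooleanInverseMeetSemigroupCat.{u} where
  obj A := ⟨MeetSemigroup A.carrier, isBooleanInverseMeetSemigroup_meetSemigroup⟩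
  map {A B} f := meetSemigroupMap (A := A.carrier) (B := B.carrier) f
  map_id _ := rfl
  map_comp _ _ := rfl

/-- A topological space, regarded as a groupoid in which all arrows are identities. -/
def UnitGroupoid (X : Type u) : Type u := X

instance (X : Type u) [h : TopologicalSpace X] : TopologicalSpace (UnitGroupoid X) := h

instance (X : Type u) : ArrowGroupoid (UnitGroupoid X) where
  dom x := x
  cod x := x
  inv x := x
  comp x _ _ := x
  dom_dom _ := rfl
  cod_dom _ := rfl
  dom_cod _ := rfl
  cod_cod _ := rfl
  dom_comp _ _ w := w
  cod_comp _ _ _ := rfl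
  comp_assoc _ _ _ _ _ := rfl
  comp_dom _ := rfl
  cod_comp_self _ := rfl
  dom_inv _ := rfl
  cod_inv _ := rfl
  inv_comp _ := rfl
  comp_inv _ := rfl

theorem isHausdorffBooleanGroupoid_unit {X : Type u} [TopologicalSpace X] (hX : IsBooleanSpace X) :
    IsHausdorffBooleanGroupoid (UnitGroupoid X) := by
  have ht2 : T2Space (UnitGroupoid X) := hX.t2
  have huniv : ∀ x : UnitGroupoid X, x ∈ identities (UnitGroupoid X) := fun _ => rfl
  have hbasis : TopologicalSpace.IsTopologicalBasis
      {U : Set (UnitGroupoid X) | IsOpen U ∧ IsCompact U ∧ IsLocalBisection U} := by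
    have : {U : Set (UnitGroupoid X) | IsOpen U ∧ IsCompact U ∧ IsLocalBisection U} =
        {U : Set X | IsOpen U ∧ IsCompact U} := by
      ext U
      exact ⟨fun h => ⟨h.1, h.2.1⟩, fun h => ⟨h.1, h.2,
        isLocalBisection_of_subset fun x _ => huniv x⟩⟩
    rw [this]
    exact hX.basis
  have ho : IsOpen (identities (UnitGroupoid X)) := by
    rw [Set.eq_univ_of_forall huniv]
    exact isOpen_univ
  refine ⟨continuous_id, continuous_fst.comp continuous_subtype_val, ?_, hbasis,
    isBooleanSpace_identities hbasis ho, ht2⟩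
  let e : UnitGroupoid X ≃ₜ identities (UnitGroupoid X) :=
    { toFun := domId
      invFun := Subtype.val
      left_inv := fun _ => rfl
      right_inv := fun _ => rfl
      continuous_toFun := continuous_id.subtype_mk _
      continuous_invFun := continuous_subtype_val }
  exact e.isLocalHomeomorph

/-- Boolean spaces and proper continuous functions, as Hausdorff Boolean groupoids all of whose
arrows are identities and proper continuous covering functors. -/
def spaceInclusion : BooleanSpaceCat.{u} ⥤ HausdorffBooleanGroupoidCat.{u} where
  obj X := ⟨UnitGroupoid X.carrier, isHausdorffBooleanGroupoid_unit X.isBoolean⟩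
  map f :=
    { toFun := f.toFun
      map_dom := fun _ => rfl
      map_cod := fun _ => rfl
      map_comp := fun _ _ _ => rfl
      star_injective := fun _ _ _ w => w
      star_surjective := fun e _ _ w => ⟨e, rfl, w.symm⟩
      continuous := f.continuous
      proper := f.proper }
  map_id _ := rfl
  map_comp _ _ := rfl

end BoolInv

/-! The two functors are already available, so the duality amounts to two natural isomorphisms: `a ↦
V a` from `S` to the compact-open bisections of its groupoid of ultrafilters, and `g ↦ {U | g ∈ U}`
from `G` to the ultrafilters of its compact-open bisections.

The first map is multiplicative because an ultrafilter `A` containing `a * b` factors as `(A · B⁻¹)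
· B` with `b ∈ B` (`V_mul`). It is injective because it reflects the order (`le_of_V_subset`): if
`a` is not below `b`, relative complements in `E(S)` cut out a nonzero part of `a` disjoint from the
meet of `a` and `b`, and by Zorn's lemma this part lies in some ultrafilter, which then contains `a`
but not `b`. It is surjective because a compact-open bisection `W` is a finite union of sets `V a`.
These `a` are compatible, since `W⁻¹W` and `WW⁻¹` consist of identities, and ultrafilters are prime,
so the join of the `a` represents `W` (`exists_mem_of_isLUB`, `exists_V_eq`).

The second map is bijective because every ultrafilter of compact-open bisections is given by an
arrow (`exists_of_isUltra`) and a Hausdorff topology separates arrows. It is a homeomorphism since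
the preimage of `V U` is `U`. Both families are natural by definition, because the functors act by
inverse images.

For classical duality, all elements of a meet semigroup are idempotent, so its ultrafilters are all
identities and the ultrafilter functor restricts to Boolean algebras and Boolean spaces. Both
embeddings are fully faithful; for algebras, the cofinality of the image comes from compactness of
`V b` (`properMorphism_exists_le`). Hence the Stone functor inherits full faithfulness from the
large equivalence, and a Boolean space is recovered from its compact-open sets. -/

namespace BoolInv

open ArrowGroupoid

/-! ### Isomorphisms of semigroups and of groupoids -/

section mulEquiv

variable {S T : Type u} [InverseSemigroupWithZero S] [InverseSemigroupWithZero T]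

/-- A multiplicative equivalence of inverse semigroups preserves the natural partial order. -/
def mulEquivOrderIso (e : S ≃* T) : S ≃o T where
  toEquiv := e.toEquiv
  map_rel_iff' {a b} := by
    refine ⟨fun h => ?_, fun h => map_le e.toMulHom h⟩
    have h1 : e.symm (e a) ≤ e.symm (e b) := map_le e.symm.toMulHom h
    rwa [e.symm_apply_apply, e.symm_apply_apply] at h1

/-- A multiplicative equivalence of inverse semigroups restricts to the idempotents. -/
def mulEquivIdemOrderIso (e : S ≃* T) : Idem S ≃o Idem T where
  toFun := idemMap e.toMulHom
  invFun := idemMap e.symm.toMulHom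
  left_inv x := Subtype.ext (e.symm_apply_apply x.1)
  right_inv x := Subtype.ext (e.apply_symm_apply x.1)
  map_rel_iff' {a b} := (mulEquivOrderIso e).le_iff_le (x := a.1) (y := b.1)

/-- Zero is determined by multiplication alone, as the absorbing element. -/
theorem mulEquiv_map_zero (e : S ≃* T) : e 0 = 0 := by
  have h : e (0 * e.symm 0) = e 0 * 0 := by rw [map_mul, e.apply_symm_apply]
  rwa [InverseSemigroupWithZero.zero_mul', InverseSemigroupWithZero.mul_zero'] at h

theorem orderIso_isGLB_pair {X Y : Type u} [PartialOrder X] [PartialOrder Y] (f : X ≃o Y)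
    {a b c : X} (h : IsGLB {a, b} c) : IsGLB {f a, f b} (f c) := by
  rw [← Set.image_pair]
  exact f.isGLB_image'.2 h

theorem orderIso_isLUB_pair {X Y : Type u} [PartialOrder X] [PartialOrder Y] (f : X ≃o Y)
    {a b c : X} (h : IsLUB {a, b} c) : IsLUB {f a, f b} (f c) := by
  rw [← Set.image_pair]
  exact f.isLUB_image'.2 h

theorem isFilter_preimage_mulEquiv (e : S ≃* T) {F : Set T} (hF : IsFilter F) :
    IsFilter (e ⁻¹' F) where
  nonempty := hF.nonempty.preimage e.surjective
  directed x y hx hy := by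
    obtain ⟨z, hz, h1, h2⟩ := hF.directed _ _ hx hy
    have hz' : e (e.symm z) = z := e.apply_symm_apply z
    refine ⟨e.symm z, by rwa [Set.mem_preimage, hz'], ?_, ?_⟩
    · exact (mulEquivOrderIso e).le_iff_le.1 (hz'.le.trans h1)
    · exact (mulEquivOrderIso e).le_iff_le.1 (hz'.le.trans h2)
  closed x y hx h := hF.closed _ _ hx (map_le e.toMulHom h)
  zero_notMem h := hF.zero_notMem (by rwa [Set.mem_preimage, mulEquiv_map_zero] at h)

/-- A filter larger than the preimage is carried by `e.symm` to a filter larger than `F`, so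
maximality is transported. -/
theorem isUltra_preimage_mulEquiv (e : S ≃* T) {F : Set T} (hF : IsUltra F) :
    IsUltra (e ⁻¹' F) := by
  refine ⟨isFilter_preimage_mulEquiv e hF.1, fun Q hQ hsub x hx => ?_⟩
  refine hF.2 (isFilter_preimage_mulEquiv e.symm hQ) (fun y hy => hsub ?_) ?_
  · rwa [Set.mem_preimage, e.apply_symm_apply]
  · rwa [Set.mem_preimage, e.symm_apply_apply]

/-- A multiplicative equivalence, as a proper morphism. -/
def properMorphismOfMulEquiv (e : S ≃* T) : ProperMorphism S T where
  -- The natural order, the idempotents, zero and the ultrafilters are all defined from the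
  -- multiplication, so a bijective homomorphism meets every condition of a proper morphism.
  __ := e.toMulHom
  map_meet _ _ _ h := orderIso_isGLB_pair (mulEquivOrderIso e) h
  map_zero := mulEquiv_map_zero e
  map_idem_meet _ _ _ h := orderIso_isGLB_pair (mulEquivIdemOrderIso e) h
  map_idem_join _ _ _ h := orderIso_isLUB_pair (mulEquivIdemOrderIso e) h
  proper _ h := isUltra_preimage_mulEquiv e h

end mulEquiv

/-- A multiplicative equivalence, as an isomorphism of Boolean inverse meet-semigroups. -/
def isoOfMulEquiv {S T : BooleanInverseMeetSemigroupCat.{u}} (e : S ≃* T) : S ≅ T where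
  hom := properMorphismOfMulEquiv e
  inv := properMorphismOfMulEquiv e.symm
  hom_inv_id := ProperMorphism.ext (funext e.symm_apply_apply)
  inv_hom_id := ProperMorphism.ext (funext e.apply_symm_apply)

/-- A homeomorphism which is compatible with the groupoid structures, as a proper continuous
covering functor. -/
def coveringFunctorOfHomeomorph {G H : Type u} [ArrowGroupoid G] [ArrowGroupoid H]
    [TopologicalSpace G] [TopologicalSpace H] (f : G ≃ₜ H) (hd : ∀ g, f (dom g) = dom (f g))
    (hc : ∀ g, f (cod g) = cod (f g))
    (hm : ∀ g h (w : dom g = cod h) (w' : dom (f g) = cod (f h)),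
      f (comp g h w) = comp (f g) (f h) w') :
    ProperCoveringFunctor G H where
  toFun := f
  map_dom := hd
  map_cod := hc
  map_comp g h w := hm g h w _
  star_injective _ _ h _ := f.injective h
  star_surjective e h _ w := by
    -- The only candidate is `f.symm h`; its domain is `e` because `f` sends both to `dom h`.
    refine ⟨f.symm h, f.injective ?_, f.apply_symm_apply h⟩
    rw [hd, f.apply_symm_apply, w]
  continuous := f.continuous
  proper _ hK := f.isCompact_preimage.2 hK

/-- A homeomorphism which is compatible with the groupoid structures, as an isomorphism of
Hausdorff Boolean groupoids. -/
def isoOfHomeomorph {G H : HausdorffBooleanGroupoidCat.{u}} (f : G ≃ₜ H)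
    (hd : ∀ g, f (dom g) = dom (f g)) (hc : ∀ g, f (cod g) = cod (f g))
    (hm : ∀ g h (w : dom g = cod h) (w' : dom (f g) = cod (f h)),
      f (comp g h w) = comp (f g) (f h) w') : G ≅ H where
  hom := coveringFunctorOfHomeomorph f hd hc hm
  inv := coveringFunctorOfHomeomorph f.symm
    (fun g => f.injective (by rw [hd, f.apply_symm_apply, f.apply_symm_apply]))
    (fun g => f.injective (by rw [hc, f.apply_symm_apply, f.apply_symm_apply]))
    (fun g h w w' => f.injective <| by
      rw [hm _ _ w' (by rw [f.apply_symm_apply, f.apply_symm_apply, w]), f.apply_symm_apply]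
      -- A composite depends on a proof that its factors match, so the factors are replaced together
      -- with that proof.
      exact comp_congr (f.apply_symm_apply g).symm (f.apply_symm_apply h).symm _ _)
  hom_inv_id := ProperCoveringFunctor.ext (funext f.symm_apply_apply)
  inv_hom_id := ProperCoveringFunctor.ext (funext f.apply_symm_apply)

/-! ### A Boolean inverse meet-semigroup is isomorphic to the bisections of its spectrum -/

section spectrum

/-! ### Separation of elements by ultrafilters -/

variable {S : Type u} [InverseSemigroupWithZero S]

/-- Zorn's lemma above the principal filter of `a`, which omits `0` as `a ≠ 0`; the union of a
nonempty chain of filters is a filter. -/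
theorem exists_ultra_mem {a : S} (ha : a ≠ 0) : ∃ A : UltrafilterGroupoid S, a ∈ A.1 := by
  have h0 : IsFilter {x | a ≤ x} :=
    { nonempty := ⟨a, le_refl a⟩
      directed := fun x y hx hy => ⟨a, le_refl a, hx, hy⟩
      closed := fun x y hx h => le_trans hx h
      zero_notMem := fun h => ha (le_zero_iff.1 h) }
  obtain ⟨M, haM, hM⟩ := zorn_subset_nonempty {F : Set S | IsFilter F} (by
    rintro c hc hchain ⟨F₀, hF₀⟩
    refine ⟨⋃₀ c, ⟨?_, ?_, ?_, ?_⟩, fun s hs => Set.subset_sUnion_of_mem hs⟩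
    · obtain ⟨x, hx⟩ := (hc hF₀).nonempty
      exact ⟨x, F₀, hF₀, hx⟩
    · rintro x y ⟨F, hF, hx⟩ ⟨F', hF', hy⟩
      rcases hchain.total hF hF' with h | h
      · obtain ⟨z, hz, h1, h2⟩ := (hc hF').directed x y (h hx) hy
        exact ⟨z, ⟨F', hF', hz⟩, h1, h2⟩
      · obtain ⟨z, hz, h1, h2⟩ := (hc hF).directed x y hx (h hy)
        exact ⟨z, ⟨F, hF, hz⟩, h1, h2⟩
    · rintro x y ⟨F, hF, hx⟩ h
      exact ⟨F, hF, (hc hF).closed x y hx h⟩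
    · rintro ⟨F, hF, h⟩
      exact (hc hF).zero_notMem h) {x | a ≤ x} h0
  exact ⟨⟨M, hM⟩, haM (show a ≤ a from le_rfl)⟩

/-- The structure `B` is an explicit argument because `Idem S` already carries the natural order;
the order of `B` agrees with it only through a proved equivalence. -/
theorem gba_sdiff_le {E : Type u} (B : GeneralizedBooleanAlgebra E) (x y : E) :
    B.le (B.sdiff x y) x := sdiff_le

theorem gba_le_of_sdiff {E : Type u} (B : GeneralizedBooleanAlgebra E) {x y : E}
    (h : B.le (B.sdiff x y) B.bot) : B.le x y := sdiff_eq_bot_iff.1 (le_bot_iff.1 h)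

/-- The relative complement of `g` in `f` is an idempotent below `f` and orthogonal to `g`; if it
vanishes then `f ≤ g`. The hypothesis is phrased by products, so that the Boolean structure of
`E(S)`, known only to exist, stays out of sight. -/
theorem idem_le_of_forall (hS : IsBooleanInverseMeetSemigroup S) {f g : S}
    (hf : IsIdempotentElem f) (hg : IsIdempotentElem g)
    (h : ∀ e, IsIdempotentElem e → e ≤ f → e * g = 0 → e = 0) : f ≤ g := by
  obtain ⟨B, hB⟩ := hS.boolean
  have h0 : IsIdempotentElem (0 : S) := InverseSemigroupWithZero.zero_mul' 0
  have hbot : (B.bot : Idem S).1 = 0 := le_zero_iff.1 ((hB B.bot ⟨0, h0⟩).1 (gba_bot_le B _))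
  let f' : Idem S := ⟨f, hf⟩
  let g' : Idem S := ⟨g, hg⟩
  let d := B.sdiff f' g'
  refine (hB f' g').1 (gba_le_of_sdiff B ((hB _ _).2 ?_))
  change d.1 ≤ (B.bot : Idem S).1
  rw [hbot, le_zero_iff]
  refine h d.1 d.2 ((hB _ _).1 (gba_sdiff_le B f' g')) ?_
  let m : Idem S := ⟨d.1 * g, idem_mul d.2 hg⟩
  have hm := idem_inf d.2 hg
  -- The product `d * g` is a lower bound of `d` and `g`, hence lies below their Boolean meet, which
  -- is bottom.
  have h1 : B.le m (B.inf d g') := B.le_inf _ _ _ ((hB m d).2 hm.1) ((hB m g').2 hm.2)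
  rw [gba_sdiff_inf, hB] at h1
  have h2 : d.1 * g ≤ (B.bot : Idem S).1 := h1
  rwa [hbot, le_zero_iff] at h2

/-- Writing `z = a * h * f` with `f` idempotent, `h` commutes past `f` and is absorbed by the other
`h`. -/
theorem mul_idem_eq_of_le {z a h : S} (hh : IsIdempotentElem h) (hz : z ≤ a * h) : z * h = z := by
  obtain ⟨f, hf, rfl⟩ := hz
  rw [mul_assoc, mul_assoc, idem_comm hf hh, ← mul_assoc h h, hh.eq, ← mul_assoc]

/-- Let `m` be the meet of `a` and `b`. Since `m = a * (m⁻¹ * m)`, it is enough that `a⁻¹ * a ≤ m⁻¹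
* m`. Otherwise some nonzero idempotent `h ≤ a⁻¹ * a` is orthogonal to `m⁻¹ * m`, and an ultrafilter
through `a * h` contains `a`, hence `b`, although nothing nonzero lies below both `a * h` and `b`.
-/
theorem le_of_V_subset (hS : IsBooleanInverseMeetSemigroup S) {a b : S} (hab : V a ⊆ V b) :
    a ≤ b := by
  obtain ⟨m, hm⟩ := hS.exists_meet a b
  have hma : m ≤ a := hm.1 (by simp)
  have hmb : m ≤ b := hm.1 (by simp)
  have key : a⁻¹ * a ≤ m⁻¹ * m := by
    refine idem_le_of_forall hS (idem_inv_mul a) (idem_inv_mul m) fun h hh hha hhm => ?_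
    by_contra hne
    -- As `h ≤ a⁻¹ * a`, the idempotent `h` is recovered as `a⁻¹ * (a * h)`.
    have hah : a * h ≠ 0 := by
      intro h0
      apply hne
      have h1 : a⁻¹ * a * h = h := by
        obtain ⟨f, -, rfl⟩ := hha
        rw [← mul_assoc, (idem_inv_mul a).eq]
      rw [← h1, mul_assoc, h0, InverseSemigroupWithZero.mul_zero']
    obtain ⟨A, hA⟩ := exists_ultra_mem hah
    have hAa : a ∈ A.1 := A.2.1.closed _ _ hA (le_of_idem_right hh)
    obtain ⟨z, hz, hz1, hz2⟩ := A.2.1.directed _ _ hA (hab hAa)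
    have hzm : z ≤ m := by
      refine hm.2 ?_
      rintro y (rfl | rfl)
      exacts [hz1.trans (le_of_idem_right hh), hz2]
    have h2 : m * h = 0 := by
      rw [← InverseSemigroup.mul_inv_mul m, mul_assoc, mul_assoc, ← mul_assoc m⁻¹,
        idem_comm (idem_inv_mul m) hh, hhm, InverseSemigroupWithZero.mul_zero']
    have h3 : z * h ≤ m * h := mul_le hzm le_rfl
    -- From `z ≤ a * h` comes `z * h = z`, while `z ≤ m` gives `z * h ≤ m * h = 0`; so `z = 0`,
    -- which no filter contains.
    rw [mul_idem_eq_of_le hh hz1, h2, le_zero_iff] at h3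
    exact A.2.1.zero_notMem (h3 ▸ hz)
  calc a = a * (a⁻¹ * a) := by rw [← mul_assoc, InverseSemigroup.mul_inv_mul]
    _ ≤ a * (m⁻¹ * m) := mul_le le_rfl key
    _ = m := (le_iff_mul_dom.1 hma).symm
    _ ≤ b := hmb

/-! ### The sets `V a` as compact-open bisections -/

theorem V_zero : V (0 : S) = ∅ :=
  Set.eq_empty_of_forall_notMem fun A hA => A.2.1.zero_notMem hA

theorem V_mono {a b : S} (h : a ≤ b) : V a ⊆ V b := fun A hA => A.2.1.closed _ _ hA h

/-- If `A` contains `a * b`, its domain contains `b⁻¹ * b`, so some ultrafilter `B` through `b` has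
the same domain as `A`. Then `A = (A · B⁻¹) · B`, and the first factor contains `a` because `a * b *
b⁻¹ ≤ a`. -/
theorem V_mul (a b : S) : V (a * b) = setMul (V a) (V b) := by
  ext A
  constructor
  · intro hA
    have h1 := ultra_dom_mem (A := A) (a := a * b) hA
    have h2 : b⁻¹ * b ∈ (dom A).1 := by
      refine (dom A).2.1.closed _ _ h1 ?_
      rw [mul_inv_rev', mul_assoc, ← mul_assoc a⁻¹]
      exact mul_le le_rfl (le_of_idem_left (idem_inv_mul a))
    obtain ⟨B, hB, hBA⟩ := exists_ultra_dom h2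
    have w : dom A = cod (inv B) := by rw [cod_inv, hBA]
    have w' : dom (comp A (inv B) w) = cod B := by rw [dom_comp, dom_inv]
    refine ⟨comp A (inv B) w, ?_, B, hB, w', (comp_comp_inv w w').symm⟩
    refine ⟨a * b, hA, b⁻¹, ⟨b, hB, rfl⟩, ?_⟩
    rw [mul_assoc]
    exact le_of_idem_right (idem_mul_inv b)
  · rintro ⟨A, hA, B, hB, w, rfl⟩
    exact ⟨a, hA, b, hB, le_rfl⟩

theorem V_inv (a : S) : V a⁻¹ = setInv (V a) := by
  ext A
  rw [mem_setInv]
  exact mem_filterInv.symm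

/-- An identity equals its own domain, so it contains `a⁻¹ * a` as soon as it contains `a`.
Reflection of the order gives `a ≤ a⁻¹ * a`, and elements below an idempotent are idempotent. -/
theorem idem_of_V_subset_identities (hS : IsBooleanInverseMeetSemigroup S) {a : S}
    (h : V a ⊆ identities (UltrafilterGroupoid S)) : IsIdempotentElem a := by
  refine idem_of_le (idem_inv_mul a) (le_of_V_subset hS fun A hA => ?_)
  have h1 : dom A = A := h hA
  have h2 := ultra_dom_mem (A := A) (a := a) hA
  rwa [h1] at h2

/-- Ultrafilters are prime. -/
theorem exists_mem_of_isLUB (hS : IsBooleanInverseMeetSemigroup S) {A : UltrafilterGroupoid S}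
    {s : Set S} (hs : s.Finite) (hne : s.Nonempty) (hc : CompatibleSet s) {j : S} (hj : IsLUB s j)
    (hjA : j ∈ A.1) : ∃ a ∈ s, a ∈ A.1 := by
  by_contra hcon
  push Not at hcon
  -- By maximality, each `a` outside `A` has a member of `A` with which it has zero meet;
  -- directedness merges these finitely many members with `j` into a single `b`.
  have hlow : ∃ b ∈ A.1, b ≤ j ∧ ∀ a ∈ s, ∀ y, y ≤ b → y ≤ a → y = 0 := by
    -- The induction passes to subsets of `s`, of which `j` need not be the join, so these
    -- hypotheses are dropped; only `j ∈ A` matters here.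
    clear hj hc hne
    induction s, hs using Set.Finite.induction_on with
    | empty => exact ⟨j, hjA, le_rfl, fun a ha => ha.elim⟩
    | @insert a s _ _ ih =>
      obtain ⟨b, hb, hbj, h⟩ := ih fun a ha => hcon a (Set.mem_insert_of_mem _ ha)
      obtain ⟨b', hb', h'⟩ := ultra_exists_of_notMem hS (hcon a (Set.mem_insert _ _))
      obtain ⟨z, hz, hzb, hzb'⟩ := A.2.1.directed b b' hb hb'
      refine ⟨z, hz, hzb.trans hbj, ?_⟩
      rintro x (rfl | hx) y hy hyx
      · exact h' y (hy.trans hzb') hyx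
      · exact h x hx y (hy.trans hzb) hyx
  obtain ⟨b, hb, hbj, h⟩ := hlow
  -- Restricting the join to the domain of `b` turns `j` into `b`, now the join of the elements `a *
  -- (b⁻¹ * b)`. Each of them lies below both `a` and `b`, hence is `0`, which forces `b = 0`.
  have h1 := hS.join_mul s hs hne hc (b⁻¹ * b) j hj
  rw [← le_iff_mul_dom.1 hbj] at h1
  have h2 : b ≤ 0 := by
    refine h1.2 ?_
    rintro _ ⟨a, ha, rfl⟩
    refine (h a ha _ ?_ (le_of_idem_right (idem_inv_mul b))).le
    have h3 : a * (b⁻¹ * b) ≤ j * (b⁻¹ * b) := mul_le (hj.1 ha) le_rfl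
    rwa [← le_iff_mul_dom.1 hbj] at h3
  rw [le_zero_iff] at h2
  exact A.2.1.zero_notMem (h2 ▸ hb)

theorem V_isLUB (hS : IsBooleanInverseMeetSemigroup S) {s : Set S} (hs : s.Finite)
    (hne : s.Nonempty) (hc : CompatibleSet s) {j : S} (hj : IsLUB s j) : V j = ⋃ a ∈ s, V a := by
  ext A
  rw [Set.mem_iUnion₂]
  constructor
  · intro hA
    obtain ⟨a, ha, h⟩ := exists_mem_of_isLUB hS hs hne hc hj hA
    exact ⟨a, ha, h⟩
  · rintro ⟨a, ha, h⟩
    exact V_mono (hj.1 ha) h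

/-- By compactness `W` is a finite union of sets `V a`. The bisection property of `W` makes these
`a` pairwise compatible, and primeness identifies `V` of their join with the union. -/
theorem exists_V_eq (hS : IsBooleanInverseMeetSemigroup S) {W : Set (UltrafilterGroupoid S)}
    (ho : IsOpen W) (hk : IsCompact W) (hW : IsLocalBisection W) : ∃ a : S, V a = W := by
  obtain ⟨s, hs, hsW⟩ := eq_finite_iUnion_of_isTopologicalBasis_of_isCompact_open V
    isTopologicalBasis_V W hk ho
  -- Joins are available for nonempty sets only; the empty union is represented by `0`.
  rcases s.eq_empty_or_nonempty with rfl | hne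
  · exact ⟨0, by rw [V_zero, hsW]; simp⟩
  have hsub : ∀ a ∈ s, V a ⊆ W := fun a ha => by
    rw [hsW]
    exact Set.subset_biUnion_of_mem (u := V) ha
  have hmul : ∀ {A B C D : Set (UltrafilterGroupoid S)}, A ⊆ C → B ⊆ D →
      setMul A B ⊆ setMul C D := by
    rintro A B C D h h' _ ⟨x, hx, y, hy, w, rfl⟩
    exact ⟨x, h hx, y, h' hy, w, rfl⟩
  have hc : CompatibleSet s := by
    intro a ha b hb
    -- Compatibility is read off in the groupoid: `V (a⁻¹ * b)` lies in `W⁻¹W` and `V (a * b⁻¹)` in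
    -- `WW⁻¹`.
    constructor <;> apply idem_of_V_subset_identities hS <;> rw [V_mul, V_inv]
    · exact (hmul (Set.image_mono (hsub a ha)) (hsub b hb)).trans hW.1
    · exact (hmul (hsub a ha) (Set.image_mono (hsub b hb))).trans hW.2
  obtain ⟨j, hj⟩ := hS.exists_join s hs hne hc
  exact ⟨j, by rw [V_isLUB hS hs hne hc hj, hsW]⟩

end spectrum

/-- The groupoid of ultrafilters of a Boolean inverse meet-semigroup. -/
abbrev spectrum (S : BooleanInverseMeetSemigroupCat.{u}) : HausdorffBooleanGroupoidCat.{u} :=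
  ultrafilterGroupoidFunctor.obj (Opposite.op S)

/-- The map `a ↦ V a` from `S` to `B(G(S))`. -/
def basicBisection (S : BooleanInverseMeetSemigroupCat.{u}) :
    S →ₙ* CompactOpenBisection (spectrum S) where
  toFun a := ⟨V a, isOpen_V a, isCompact_V S.isBoolean a, isLocalBisection_V a⟩
  map_mul' a b := CompactOpenBisection.ext (V_mul a b)

theorem basicBisection_bijective (S : BooleanInverseMeetSemigroupCat.{u}) :
    Function.Bijective (basicBisection S) := by
  constructor
  · intro a b h
    have h1 : V a = V b := congrArg CompactOpenBisection.carrier h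
    exact le_antisymm (le_of_V_subset S.isBoolean h1.subset)
      (le_of_V_subset S.isBoolean h1.symm.subset)
  · intro W
    obtain ⟨a, ha⟩ := exists_V_eq S.isBoolean W.2 W.3 W.4
    exact ⟨a, CompactOpenBisection.ext ha⟩

/-- The isomorphism of `S` with `B(G(S))`. -/
noncomputable def basicBisectionIso (S : BooleanInverseMeetSemigroupCat.{u}) :
    S ≅ (bisectionFunctor.obj (spectrum S)).unop :=
  isoOfMulEquiv (T := (bisectionFunctor.obj (spectrum S)).unop)
    (MulEquiv.ofBijective (basicBisection S) (basicBisection_bijective S))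

/-! ### A Hausdorff Boolean groupoid is isomorphic to the ultrafilters of its bisections -/

section points

variable (G : HausdorffBooleanGroupoidCat.{u})

/-- The ultrafilter of the compact-open local bisections which contain a given arrow. -/
def pointUltrafilter (g : G) : UltrafilterGroupoid (CompactOpenBisection G) :=
  ⟨{U | g ∈ U.1}, isUltra_bisections g⟩

/-- For `g ≠ h`, points being closed, a basic compact-open bisection contains `g` but not `h`.
Surjectivity is the fact that the members of an ultrafilter have a common arrow, by compactness. -/
theorem pointUltrafilter_bijective : Function.Bijective (pointUltrafilter G) := by
  have := G.isBoolean.t2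
  constructor
  · intro g h hgh
    by_contra hne
    obtain ⟨U, hU, hgU, hUh⟩ := G.isBoolean.basis.exists_subset_of_mem_open
      (show g ∈ ({h}ᶜ : Set G) from hne) isOpen_compl_singleton
    have h1 : {U : CompactOpenBisection G | g ∈ U.1} = {U | h ∈ U.1} :=
      congrArg UltrafilterGroupoid.carrier hgh
    have h2 : (⟨U, hU.1, hU.2.1, hU.2.2⟩ : CompactOpenBisection G) ∈
      {U : CompactOpenBisection G | g ∈ U.1} := hgU
    rw [h1] at h2
    exact hUh h2 rfl
  · intro F
    obtain ⟨g, hg⟩ := exists_of_isUltra F.2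
    exact ⟨g, UltrafilterGroupoid.ext hg.symm⟩

theorem pointUltrafilter_preimage (U : CompactOpenBisection G) :
    pointUltrafilter G ⁻¹' V U = U.1 := rfl

theorem pointUltrafilter_continuous : Continuous (pointUltrafilter G) := by
  refine continuous_generateFrom_iff.2 ?_
  rintro _ ⟨U, rfl⟩
  exact U.2

/-- The preimage of `V U` is `U`, so surjectivity makes `V U` the image of `U`; it suffices to check
this on the basis of compact-open bisections. -/
theorem pointUltrafilter_isOpenMap : IsOpenMap (pointUltrafilter G) := by
  refine G.isBoolean.basis.isOpenMap_iff.2 ?_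
  rintro U ⟨h1, h2, h3⟩
  have h := Set.image_preimage_eq (V (⟨U, h1, h2, h3⟩ : CompactOpenBisection G))
    (pointUltrafilter_bijective G).2
  rw [pointUltrafilter_preimage] at h
  exact h ▸ isOpen_V _

/-- The homeomorphism of `G` with the space of ultrafilters of `B(G)`. -/
noncomputable def pointUltrafilterHomeomorph :
    G ≃ₜ UltrafilterGroupoid (CompactOpenBisection G) :=
  (Equiv.ofBijective _ (pointUltrafilter_bijective G)).toHomeomorphOfContinuousOpen
    (pointUltrafilter_continuous G) (pointUltrafilter_isOpenMap G)

/-- Since ultrafilters are maximal filters, one inclusion is enough: if `U` and `W` contain `g`,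
then `U⁻¹W` contains `g⁻¹g = dom g`. The statements for codomains and composites follow the same
pattern. -/
theorem pointUltrafilter_dom (g : G) :
    pointUltrafilter G (dom g) = dom (pointUltrafilter G g) := by
  symm
  apply ultra_eq_of_subset
  rintro X ⟨_, ⟨U, hU, rfl⟩, W, hW, h⟩
  exact bisection_le_iff.1 h ⟨inv g, ⟨g, hU, rfl⟩, g, hW, dom_inv g, (inv_comp g).symm⟩

theorem pointUltrafilter_cod (g : G) :
    pointUltrafilter G (cod g) = cod (pointUltrafilter G g) := by
  symm
  apply ultra_eq_of_subset
  rintro X ⟨U, hU, _, ⟨W, hW, rfl⟩, h⟩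
  exact bisection_le_iff.1 h ⟨g, hU, inv g, ⟨g, hW, rfl⟩, (cod_inv g).symm, (comp_inv g).symm⟩

theorem pointUltrafilter_comp (g h : G) (w : dom g = cod h)
    (w' : dom (pointUltrafilter G g) = cod (pointUltrafilter G h)) :
    pointUltrafilter G (comp g h w) = comp (pointUltrafilter G g) (pointUltrafilter G h) w' := by
  symm
  apply ultra_eq_of_subset
  rintro X ⟨U, hU, W, hW, hX⟩
  exact bisection_le_iff.1 hX ⟨g, hU, h, hW, w, rfl⟩

/-- The isomorphism of `G` with `G(B(G))`. -/
noncomputable def pointUltrafilterIso :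
    G ≅ ultrafilterGroupoidFunctor.obj (bisectionFunctor.obj G) :=
  isoOfHomeomorph (H := ultrafilterGroupoidFunctor.obj (bisectionFunctor.obj G))
    (pointUltrafilterHomeomorph G) (pointUltrafilter_dom G) (pointUltrafilter_cod G)
    (pointUltrafilter_comp G)

end points

/-! ### The dual equivalence -/

/-- The natural isomorphism of the identity with `S ↦ B(G(S))`. -/
noncomputable def basicBisectionNatIso :
    𝟭 BooleanInverseMeetSemigroupCat.{u}ᵒᵖ ≅ ultrafilterGroupoidFunctor ⋙ bisectionFunctor :=
  (NatIso.ofComponents (F := ultrafilterGroupoidFunctor ⋙ bisectionFunctor)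
    (G := 𝟭 BooleanInverseMeetSemigroupCat.{u}ᵒᵖ) (fun S => (basicBisectionIso S.unop).op)
    -- Naturality says that the preimage of `V a` under `θ⁻¹` is `V (θ a)`, which holds by
    -- definition.
    (fun _ => rfl)).symm

/-- The natural isomorphism of `G ↦ G(B(G))` with the identity. -/
noncomputable def pointUltrafilterNatIso :
    bisectionFunctor ⋙ ultrafilterGroupoidFunctor ≅ 𝟭 HausdorffBooleanGroupoidCat.{u} :=
  (NatIso.ofComponents (F := 𝟭 HausdorffBooleanGroupoidCat.{u})
    (G := bisectionFunctor ⋙ ultrafilterGroupoidFunctor) (fun G => pointUltrafilterIso G)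
    -- Naturality says that `g ∈ α⁻¹(U)` exactly when `α g ∈ U`, again by definition.
    (fun _ => rfl)).symm

/-- The dual equivalence between Boolean inverse meet-semigroups and Hausdorff Boolean
groupoids. -/
noncomputable def duality :
    BooleanInverseMeetSemigroupCat.{u}ᵒᵖ ≌ HausdorffBooleanGroupoidCat.{u} :=
  -- The constructor may change the unit to obtain the triangle identity, but it keeps both functors
  -- as they are.
  CategoryTheory.Equivalence.mk ultrafilterGroupoidFunctor bisectionFunctor basicBisectionNatIso
    pointUltrafilterNatIso

/-! ### Classical Stone duality -/

theorem V_meetSemigroup_subset_iff {A : Type u} [GeneralizedBooleanAlgebra A]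
    {a b : MeetSemigroup A} : V a ⊆ V b ↔ a.val ≤ b.val :=
  ⟨fun h => meetSemigroup_le_iff.1 (le_of_V_subset isBooleanInverseMeetSemigroup_meetSemigroup h),
    fun h => V_mono (meetSemigroup_le_iff.2 h)⟩

/-- Every element of a meet semigroup is idempotent, so preserving joins of idempotents is
preserving all binary joins. -/
theorem properMorphism_map_sup {A B : Type u} [GeneralizedBooleanAlgebra A]
    [GeneralizedBooleanAlgebra B] (φ : ProperMorphism (MeetSemigroup A) (MeetSemigroup B))
    (a b : A) : (φ.toFun ⟨a ⊔ b⟩).val = (φ.toFun ⟨a⟩).val ⊔ (φ.toFun ⟨b⟩).val := by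
  let mk : ∀ {C : Type u} [GeneralizedBooleanAlgebra C], C → Idem (MeetSemigroup C) :=
    fun c => ⟨⟨c⟩, meetSemigroup_idem _⟩
  have hsup : ∀ {C : Type u} [GeneralizedBooleanAlgebra C] (x y : C),
      IsLUB {mk x, mk y} (mk (x ⊔ y)) := by
    intro C _ x y
    constructor
    · rintro z (rfl | rfl)
      exacts [meetSemigroup_le_iff.2 le_sup_left, meetSemigroup_le_iff.2 le_sup_right]
    · intro z hz
      exact meetSemigroup_le_iff.2 (sup_le
        (meetSemigroup_le_iff.1 (hz (Set.mem_insert _ _)))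
        (meetSemigroup_le_iff.1 (hz (Set.mem_insert_of_mem _ rfl))))
  have h := (φ.map_idem_join _ _ _ (hsup a b)).unique
    (hsup (φ.toFun ⟨a⟩).val (φ.toFun ⟨b⟩).val)
  exact congrArg (fun e => MeetSemigroup.val (Subtype.val e)) h

/-- An ultrafilter of `B` has a nonempty preimage, so the open sets `V (φ a)` cover the compact set
`V b`. The join of the finitely many `a` in a subcover is the required element. -/
theorem properMorphism_exists_le {A B : Type u} [GeneralizedBooleanAlgebra A]
    [GeneralizedBooleanAlgebra B] (φ : ProperMorphism (MeetSemigroup A) (MeetSemigroup B))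
    (b : B) : ∃ a : A, b ≤ (φ.toFun ⟨a⟩).val := by
  have hmono : ∀ {a a' : A}, a ≤ a' → φ.toFun ⟨a⟩ ≤ φ.toFun ⟨a'⟩ := fun h =>
    map_le φ.toMulHom (meetSemigroup_le_iff.2 h)
  obtain ⟨t, ht⟩ := (isCompact_V isBooleanInverseMeetSemigroup_meetSemigroup
      (⟨b⟩ : MeetSemigroup B)).elim_finite_subcover (fun a : A => V (φ.toFun ⟨a⟩))
    (fun a => isOpen_V _) (fun F _ => by
      obtain ⟨a, ha⟩ := (φ.proper _ F.2).1.nonempty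
      exact Set.mem_iUnion.2 ⟨a.val, ha⟩)
  refine ⟨t.sup id, V_meetSemigroup_subset_iff.1 (ht.trans ?_)⟩
  exact Set.iUnion₂_subset fun a ha => V_mono (hmono (Finset.le_sup (f := id) ha))

/-- A proper morphism between Boolean algebras, as a proper homomorphism. -/
def properBooleanHomOfProperMorphism {A B : Type u} [GeneralizedBooleanAlgebra A]
    [GeneralizedBooleanAlgebra B] (φ : ProperMorphism (MeetSemigroup A) (MeetSemigroup B)) :
    ProperBooleanHom A B where
  toFun a := (φ.toFun ⟨a⟩).val
  map_sup' := properMorphism_map_sup φ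
  map_inf' a b := congrArg MeetSemigroup.val (φ.map_mul' ⟨a⟩ ⟨b⟩)
  map_bot := congrArg MeetSemigroup.val φ.map_zero
  proper := properMorphism_exists_le φ

/-- A proper morphism of meet semigroups preserves meets as products, joins as joins of idempotents,
and satisfies cofinality by compactness, so it is already a proper homomorphism with the same
underlying map. -/
instance algebraInclusion_full : algebraInclusion.{u}.Full where
  map_surjective φ := ⟨properBooleanHomOfProperMorphism φ, rfl⟩

instance algebraInclusion_faithful : algebraInclusion.{u}.Faithful where
  map_injective {A B f g} h := by
    apply ProperBooleanHom.ext
    funext a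
    exact congrArg (fun φ : ProperMorphism (MeetSemigroup A.carrier) (MeetSemigroup B.carrier) =>
      (φ.toFun ⟨a⟩).val) h

/-- Between groupoids of identities the algebraic conditions on a covering functor carry no data,
and only the proper continuous map is left. -/
instance spaceInclusion_full : spaceInclusion.{u}.Full where
  map_surjective φ := ⟨⟨φ.toFun, φ.continuous, φ.proper⟩, rfl⟩

instance spaceInclusion_faithful : spaceInclusion.{u}.Faithful where
  map_injective {X Y _ _} h := ProperContinuousMap.ext (congrArg
    (ProperCoveringFunctor.toFun (G := UnitGroupoid X.carrier) (H := UnitGroupoid Y.carrier)) h)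

/-! ### The Stone functor and its comparison with the groupoid of ultrafilters -/

theorem isBooleanSpace_ultra {S : Type u} [InverseSemigroupWithZero S]
    (hS : IsBooleanInverseMeetSemigroup S) : IsBooleanSpace (UltrafilterGroupoid S) where
  t2 := t2_ultra hS
  basis := TopologicalSpace.isTopologicalBasis_of_isOpen_of_nhds (fun _ hU => hU.1)
    fun A U hA hU => by
      obtain ⟨W, hW, h⟩ := (basis_ultra hS).exists_subset_of_mem_open hA hU
      exact ⟨W, ⟨hW.1, hW.2.1⟩, h⟩

/-- The Stone functor, which sends a Boolean algebra to its space of ultrafilters. -/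
def stoneFunctor : BooleanAlgebraCat.{u}ᵒᵖ ⥤ BooleanSpaceCat.{u} where
  obj A := ⟨UltrafilterGroupoid (MeetSemigroup A.unop.carrier),
    isBooleanSpace_ultra isBooleanInverseMeetSemigroup_meetSemigroup⟩
  map f :=
    let α := ultrafilterGroupoidFunctor.map (algebraInclusion.map f.unop).op
    ⟨α.toFun, α.continuous, α.proper⟩
  map_id _ := rfl
  map_comp _ _ := rfl

/-- A Hausdorff Boolean groupoid all of whose arrows are identities comes from a space. -/
def unitGroupoidIso (G : HausdorffBooleanGroupoidCat.{u}) (hG : IsBooleanSpace G)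
    (h : ∀ g : G, g ∈ identities G) : spaceInclusion.obj ⟨G, hG⟩ ≅ G :=
  isoOfHomeomorph (G := spaceInclusion.obj ⟨G, hG⟩) (Homeomorph.refl G)
    -- The underlying space is unchanged; only the given domain, codomain and composition have to be
    -- matched with the trivial ones.
    (fun g => (h g).symm) (fun g => (cod_of_identity (h g)).symm)
    (fun _ k _ w' => (comp_identity (h k) w').symm)

/-- The Stone functor agrees with `G` along the inclusions. -/
def stoneFunctorCompIso : stoneFunctor.{u} ⋙ spaceInclusion ≅
    algebraInclusion.op ⋙ ultrafilterGroupoidFunctor :=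
  NatIso.ofComponents
    (fun A => unitGroupoidIso
      (ultrafilterGroupoidFunctor.obj (Opposite.op (algebraInclusion.obj A.unop)))
      (isBooleanSpace_ultra isBooleanInverseMeetSemigroup_meetSemigroup) fun F => by
        -- An ultrafilter containing an idempotent is an identity, and here every element is
        -- idempotent.
        obtain ⟨a, ha⟩ := UltrafilterGroupoid.isUltra F |>.1.nonempty
        exact ultra_dom_eq_of_idem (meetSemigroup_idem a) ha)
    (fun _ => rfl)

/-- The compact-open sets of a Boolean space are the compact-open local bisections of the
corresponding groupoid. -/
def compactOpensMulEquiv (X : BooleanSpaceCat.{u}) [T2Space X.carrier] :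
    MeetSemigroup (TopologicalSpace.CompactOpens X.carrier) ≃*
      CompactOpenBisection (spaceInclusion.obj X) where
  toFun K := ⟨K.val.carrier, K.val.isOpen, K.val.isCompact, isLocalBisection_of_subset fun _ _ => rfl⟩
  invFun U := ⟨⟨⟨U.1, U.3⟩, U.2⟩⟩
  left_inv _ := rfl
  right_inv _ := rfl
  -- Identities are composable only when equal, so the product of two sets of identities is their
  -- intersection.
  map_mul' K L := CompactOpenBisection.ext <| by
    refine (Set.ext fun x => ⟨fun hx => ⟨x, hx.1, x, hx.2, rfl, rfl⟩, ?_⟩)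
    rintro ⟨y, hy, z, hz, w, h⟩
    have hx : x = y := h
    have hz' : x = z := hx.trans w
    exact ⟨hx ▸ hy, hz' ▸ hz⟩

instance ultrafilterGroupoidFunctor_isEquivalence :
    ultrafilterGroupoidFunctor.{u}.IsEquivalence :=
  duality.isEquivalence_functor

/-- Followed by the embedding of spaces, the Stone functor is isomorphic to the embedding of
algebras followed by an equivalence. As both embeddings are fully faithful, so is the Stone functor.
Essential surjectivity does not follow from this and uses the algebra of compact-open sets. -/
instance stoneFunctor_isEquivalence : stoneFunctor.{u}.IsEquivalence where
  faithful := Functor.Faithful.of_comp_iso stoneFunctorCompIso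
  full := Functor.Full.of_comp_faithful_iso stoneFunctorCompIso
  essSurj := ⟨fun X => by
    have := X.isBoolean.t2
    let A : BooleanAlgebraCat.{u} := ⟨TopologicalSpace.CompactOpens X.carrier⟩
    let e : algebraInclusion.obj A ≅ (bisectionFunctor.obj (spaceInclusion.obj X)).unop :=
      isoOfMulEquiv (S := algebraInclusion.obj A)
        (T := (bisectionFunctor.obj (spaceInclusion.obj X)).unop) (compactOpensMulEquiv X)
    -- The chain of isomorphisms lives in groupoids: the Stone space of `A` is its groupoid of
    -- ultrafilters, `A` is the semigroup of bisections of `X`, and the ultrafilters of the latter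
    -- are the points of `X`. Full faithfulness of the embedding brings the composite back to
    -- spaces.
    exact ⟨Opposite.op A, ⟨spaceInclusion.preimageIso
      (stoneFunctorCompIso.app (Opposite.op A) ≪≫ ultrafilterGroupoidFunctor.mapIso e.op.symm ≪≫
        (pointUltrafilterIso (spaceInclusion.obj X)).symm)⟩⟩⟩

end BoolInv

/-! ### The duality theorem -/

theorem mainTheorem2 :
    (∃ e : BoolInv.BooleanInverseMeetSemigroupCat.{u}ᵒᵖ ≌ BoolInv.HausdorffBooleanGroupoidCat.{u},
      e.functor = BoolInv.ultrafilterGroupoidFunctor ∧ e.inverse = BoolInv.bisectionFunctor) ∧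
    (BoolInv.algebraInclusion.{u}.Full ∧ BoolInv.algebraInclusion.{u}.Faithful ∧
      BoolInv.spaceInclusion.{u}.Full ∧ BoolInv.spaceInclusion.{u}.Faithful ∧
      ∃ F : BoolInv.BooleanAlgebraCat.{u}ᵒᵖ ≌ BoolInv.BooleanSpaceCat.{u},
        Nonempty (F.functor ⋙ BoolInv.spaceInclusion ≅
          BoolInv.algebraInclusion.op ⋙ BoolInv.ultrafilterGroupoidFunctor)) :=
  ⟨⟨BoolInv.duality, rfl, rfl⟩, inferInstance, inferInstance, inferInstance, inferInstance,
    BoolInv.stoneFunctor.asEquivalence, ⟨BoolInv.stoneFunctorCompIso⟩⟩
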